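/- **Notation.** For $n\ge 1$ let $\mathrm{Conv}_n$ be the set of bounded convex subsets of $\mathbb{R}^n$ with nonempty interior. For a lattice $L\subset\mathbb{R}^n$ and $\mathcal K\in\mathrm{Conv}_n$, the pair $(L,\mathcal K)$ is a *packing* if the translates $\ell+\mathcal K$, $\ell\in L$, are pairwise disjoint, and a *covering* if $L+\mathcal K=\mathbb{R}^n$. With $N(L,\mathcal K,x)=|L\cap(\mathcal K+x)|$, the *covering smoothness* of $L$ with respect to $\mathcal K$ is $$\eta(\mathcal K,L)=\sup_{x\in\mathbb{R}^n}\left|\frac{N(L,\mathcal K,x)}{\mathrm{vol}(\mathcal K)/\mathrm{covol}(L)}-1\right|.$$ For a prime $p$, $\mathrm{Gr}_{n,r}(\mathbb{F}_p)$ is the set of $r$-dimensional subspaces of $\mathbb{F}_p^n$, and $\pi_p:\mathbb{Z}^n\to\mathbb{F}_p^n$ is coordinatewise reduction mod $p$. Given $L=g\mathbb{Z}^n$ with $g$ an invertible real $n\times n$ matrix, and $S\in\mathrm{Gr}_{n,r}(\mathbb{F}_p)$, put $L(S)=\frac1p\, g\,\pi_p^{-1}(S)$, a lattice containing $L$. Logarithms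 without a base are natural. **Theorem 3.4.** Let $n\ge 5$, let $\delta,\tau\in(0,1)$, and let $p$ be a prime with $p>64n/(\tau\delta)^2$. Let $L=g\mathbb{Z}^n\subset\mathbb{R}^n$ be a lattice and $\mathcal K\in\mathrm{Conv}_n$, and assume that there is a real number $c$ with $1<c<\frac{p}{2n}$ such that $\left(L,\left(1+\frac cp\right)\mathcal K\right)$ is a packing and $(L,c\,\mathcal K)$ is a covering. Let $4\le r\le n$ be an integer with $$r>3+\log_p\frac{\mathrm{covol}(L)}{\mathrm{vol}(\mathcal K)}+3c\,\frac{n}{p\log p}.$$ Then, for $S$ uniformly distributed on $\mathrm{Gr}_{n,r}(\mathbb{F}_p)$, $$\Pr\left(\eta(\mathcal K,L(S))\ge\tau+8c\,\frac np\right)<2\delta.$$ -/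

import Mathlib

open scoped Pointwise

namespace SmoothCover

/-- Bounded convex subsets of `ℝⁿ` with nonempty interior. They need not be closed, symmetric,
nor contain the origin. -/
def IsConvBody {n : ℕ} (K : Set (EuclideanSpace ℝ (Fin n))) : Prop :=
  Convex ℝ K ∧ Bornology.IsBounded K ∧ (interior K).Nonempty

/-- `(L, K)` is a packing: the translates `ℓ + K`, `ℓ ∈ L`, are pairwise disjoint. -/
def IsPacking {n : ℕ} (L : Submodule ℤ (EuclideanSpace ℝ (Fin n)))
    (K : Set (EuclideanSpace ℝ (Fin n))) : Prop :=
  (L : Set (EuclideanSpace ℝ (Fin n))).PairwiseDisjoint (fun l => l +ᵥ K)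

/-- `(L, K)` is a covering: `L + K = ℝⁿ`. -/
def IsCovering {n : ℕ} (L : Submodule ℤ (EuclideanSpace ℝ (Fin n)))
    (K : Set (EuclideanSpace ℝ (Fin n))) : Prop :=
  (L : Set (EuclideanSpace ℝ (Fin n))) + K = Set.univ

/-- `N(L, K, x) = |L ∩ (K + x)|`; the set is finite when `L` is discrete and `K` bounded, see
`finite_inter_vadd`. -/
noncomputable def coverCount {n : ℕ} (L : Submodule ℤ (EuclideanSpace ℝ (Fin n)))
    (K : Set (EuclideanSpace ℝ (Fin n))) (x : EuclideanSpace ℝ (Fin n)) : ℕ :=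
  ((L : Set (EuclideanSpace ℝ (Fin n))) ∩ (x +ᵥ K)).ncard

/-- The covering smoothness `η(K, L)` of a lattice `L` with respect to `K`. For bounded `K` the
supremum is over a bounded set of reals, see `bddAbove_smoothness`. -/
noncomputable def smoothness {n : ℕ} (K : Set (EuclideanSpace ℝ (Fin n)))
    (L : Submodule ℤ (EuclideanSpace ℝ (Fin n))) [DiscreteTopology L] [IsZLattice ℝ L] : ℝ :=
  ⨆ x : EuclideanSpace ℝ (Fin n),
    |(coverCount L K x : ℝ) / (MeasureTheory.volume.real K / ZLattice.covolume L) - 1|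

/-- The super-lattice `L(S) = (1/p) g π_p⁻¹(S)` of `L = g ℤⁿ`, where the columns of `g` are the
`ℤ`-basis `b` of `L` and `π_p : ℤⁿ → 𝔽_pⁿ` is coordinatewise reduction mod `p`. -/
noncomputable def superlattice {n : ℕ} {L : Submodule ℤ (EuclideanSpace ℝ (Fin n))}
    (b : Module.Basis (Fin n) ℤ L) (p : ℕ) (S : Submodule (ZMod p) (Fin n → ZMod p)) :
    Submodule ℤ (EuclideanSpace ℝ (Fin n)) where
  carrier := {x | ∃ z : Fin n → ℤ, (fun i => (z i : ZMod p)) ∈ S ∧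
    x = (p : ℝ)⁻¹ • ∑ i, z i • (b i : EuclideanSpace ℝ (Fin n))}
  zero_mem' := ⟨0, by convert S.zero_mem using 1; ext i; simp, by simp⟩
  add_mem' := by
    rintro x y ⟨z, hz, rfl⟩ ⟨w, hw, rfl⟩
    refine ⟨z + w, by simpa [Pi.add_def] using S.add_mem hz hw, ?_⟩
    simp [add_smul, Finset.sum_add_distrib]
  smul_mem' := by
    rintro a x ⟨z, hz, rfl⟩
    refine ⟨a • z, by simpa [Pi.smul_def] using S.smul_mem (a : ZMod p) hz, ?_⟩
    simp only [Pi.smul_apply, smul_assoc, ← Finset.smul_sum]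
    rw [smul_comm]

instance superlattice_discrete {n : ℕ} {L : Submodule ℤ (EuclideanSpace ℝ (Fin n))}
    [DiscreteTopology L] (b : Module.Basis (Fin n) ℤ L) (p : ℕ) [Fact p.Prime]
    (S : Submodule (ZMod p) (Fin n → ZMod p)) : DiscreteTopology (superlattice b p S) := by
  have hp : (p : ℝ) ≠ 0 := by exact_mod_cast (Fact.out : p.Prime).ne_zero
  have hmem : ∀ x : superlattice b p S, (p : ℝ) • (x : EuclideanSpace ℝ (Fin n)) ∈ L := by
    rintro ⟨x, z, -, rfl⟩
    simp only [smul_inv_smul₀ hp]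
    exact L.sum_mem fun i _ => L.smul_mem _ (b i).2
  refine DiscreteTopology.of_continuous_injective
    (f := fun x : superlattice b p S => (⟨_, hmem x⟩ : L)) (by fun_prop) ?_
  intro x y h
  exact Subtype.ext (smul_right_injective _ hp (congrArg Subtype.val h))

instance superlattice_isZLattice {n : ℕ} {L : Submodule ℤ (EuclideanSpace ℝ (Fin n))}
    [DiscreteTopology L] [IsZLattice ℝ L] (b : Module.Basis (Fin n) ℤ L) (p : ℕ) [Fact p.Prime]
    (S : Submodule (ZMod p) (Fin n → ZMod p)) : IsZLattice ℝ (superlattice b p S) := by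
  have hp : (p : ℝ) ≠ 0 := by exact_mod_cast (Fact.out : p.Prime).ne_zero
  have hle : (L : Set (EuclideanSpace ℝ (Fin n))) ⊆ superlattice b p S := by
    intro x hx
    refine ⟨fun i => (p : ℤ) * b.repr ⟨x, hx⟩ i, ?_, ?_⟩
    · convert S.zero_mem using 1
      ext i
      simp
    · have h : ∑ i, b.repr ⟨x, hx⟩ i • (b i : EuclideanSpace ℝ (Fin n)) = x := by
        simpa only [Submodule.coe_sum, Submodule.coe_smul] using
          congrArg Subtype.val (b.sum_repr ⟨x, hx⟩)
      rw [eq_inv_smul_iff₀ hp]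
      simp only [mul_smul, ← Finset.smul_sum]
      rw [h, ← Int.cast_smul_eq_zsmul ℝ, Int.cast_natCast]
  exact ⟨top_le_iff.mp ((IsZLattice.span_top (K := ℝ) (L := L)).symm.le.trans
    (Submodule.span_mono hle))⟩

theorem finite_inter_vadd {n : ℕ} (L : Submodule ℤ (EuclideanSpace ℝ (Fin n)))
    [DiscreteTopology L] {K : Set (EuclideanSpace ℝ (Fin n))} (hK : Bornology.IsBounded K)
    (x : EuclideanSpace ℝ (Fin n)) :
    ((L : Set (EuclideanSpace ℝ (Fin n))) ∩ (x +ᵥ K)).Finite := by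
  rw [Set.inter_comm]
  have : DiscreteTopology L.toAddSubgroup := ‹DiscreteTopology L›
  exact Metric.finite_isBounded_inter_isClosed (s := (L : Set (EuclideanSpace ℝ (Fin n))))
    DiscreteTopology.isDiscrete (hK.vadd x)
    (inferInstanceAs (IsClosed (L.toAddSubgroup : Set (EuclideanSpace ℝ (Fin n)))))

theorem bddAbove_smoothness {n : ℕ} {K : Set (EuclideanSpace ℝ (Fin n))}
    (hK : Bornology.IsBounded K) (L : Submodule ℤ (EuclideanSpace ℝ (Fin n)))
    [DiscreteTopology L] [IsZLattice ℝ L] :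
    BddAbove (Set.range fun x : EuclideanSpace ℝ (Fin n) =>
      |(coverCount L K x : ℝ) / (MeasureTheory.volume.real K / ZLattice.covolume L) - 1|) := by
  let b := (Module.Free.chooseBasis ℤ L).ofZLatticeBasis ℝ L
  have hb : Submodule.span ℤ (Set.range b) = L :=
    (Module.Free.chooseBasis ℤ L).ofZLatticeBasis_span ℝ L
  have hB : Bornology.IsBounded (ZSpan.fundamentalDomain b + K) :=
    (ZSpan.fundamentalDomain_isBounded b).add hK
  have key : ∀ x, coverCount L K x ≤ coverCount L (ZSpan.fundamentalDomain b + K) 0 := by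
    intro x
    set l : EuclideanSpace ℝ (Fin n) := (ZSpan.floor b x : EuclideanSpace ℝ (Fin n)) with hl
    have hlL : l ∈ L := hb ▸ (ZSpan.floor b x).2
    refine Set.ncard_le_ncard_of_injOn (fun y => y - l) ?_ (sub_left_injective.injOn)
      (finite_inter_vadd L hB 0)
    rintro y ⟨hy, k, hk, rfl⟩
    refine ⟨L.sub_mem hy hlL, ?_⟩
    rw [zero_vadd]
    refine ⟨x - l, ZSpan.fract_mem_fundamentalDomain b x, k, hk, ?_⟩
    simp only [vadd_eq_add]
    abel
  set v := MeasureTheory.volume.real K / ZLattice.covolume L with hv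
  have hv0 : 0 ≤ v := div_nonneg MeasureTheory.measureReal_nonneg (ZLattice.covolume_pos L).le
  refine ⟨(coverCount L (ZSpan.fundamentalDomain b + K) 0 : ℝ) / v + 1, ?_⟩
  rintro _ ⟨x, rfl⟩
  have h1 : (coverCount L K x : ℝ) / v ≤ coverCount L (ZSpan.fundamentalDomain b + K) 0 / v :=
    div_le_div_of_nonneg_right (by exact_mod_cast key x) hv0
  have h2 : 0 ≤ (coverCount L K x : ℝ) / v := by positivity
  rw [abs_le]
  constructor <;> linarith

/-- The Grassmannian `Gr_{n,r}(𝔽_p)` of `r`-dimensional subspaces of `𝔽_pⁿ`. -/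
def grassmannian (n r p : ℕ) [Fact p.Prime] : Set (Submodule (ZMod p) (Fin n → ZMod p)) :=
  {S | Module.finrank (ZMod p) S = r}

/-- The probability that a uniformly random `S ∈ Gr_{n,r}(𝔽_p)` satisfies `P` (meaningful when
`r ≤ n`, so that the finite set `Gr_{n,r}(𝔽_p)` is nonempty). -/
noncomputable def grassmannianProb (n r p : ℕ) [Fact p.Prime]
    (P : Submodule (ZMod p) (Fin n → ZMod p) → Prop) : ℝ :=
  ({S ∈ grassmannian n r p | P S}.ncard : ℝ) / ((grassmannian n r p).ncard : ℝ)

end SmoothCover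

/-! Put `u = c / p`. Since `(1 + u) • K` packs, the points of `(1/p) L` in `(1 ± u) • K` reduce
injectively mod `p`, to sets `A` in `𝔽_pⁿ`. Since `u • K` covers with `(1/p) L`, any translate of
`K` can be rounded to a point of `(1/p) L`, so each count for `L(S)` lies between the number of
points of the smaller `A` in some translate of `S` and the number of points of the larger `A` in
another. Averaging over a fundamental domain shows that `A` has the expected size `pⁿ vol K / covol
L` up to factors `(1 ± 2u)ⁿ`. It remains to show that for most `S` every translate of `S` meets `A`
in roughly the expected number of points, with failure probability below `δ` for each of the two
one-sided bounds.

This is done by the polynomial method (`ncard_heavy_flats_le`). Given weights `w` on `𝔽_pⁿ` of small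
`ℓⁿ` norm, counting coefficients yields a nonzero `P` of degree at most `d` vanishing at each `a` to
order `w a`. If a translate of `S` has average weight above `d / p`, Schwartz–Zippel with
multiplicities forces `P` to vanish on it identically. Then the top form of `P` vanishes at the
point `∑ j, θ j • v j` of `𝔽_{p^r}ⁿ`, where `v` is any basis of `S` and `θ` a basis of `𝔽_{p^r}`
over `𝔽_p`. Ordinary Schwartz–Zippel over `𝔽_{p^r}` bounds the proportion of such `S` by `2d / p^r`.

In `ncard_unbalanced_lt` the weights are about `n p^(r-2)`, shifted on `A` by a relative amount of
order `τ / n`: upwards to detect translates with too many points of `A`, downwards for those with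
too few. Then `d` is of order `n p^(r-1)`, and the proportion of bad directions is `O(n / p)`. -/

namespace MvPolynomial

/-! ### Order of vanishing, and Schwartz–Zippel with multiplicities. -/

variable {σ R : Type*} [CommRing R]

/-- The substitution `X ↦ X + a`. -/
noncomputable def shift (a : σ → R) : MvPolynomial σ R →ₐ[R] MvPolynomial σ R :=
  aeval fun i => X i + C (a i)

/-- `P` vanishes to order at least `m` at the point `a`. -/
def VanishesToOrder (P : MvPolynomial σ R) (a : σ → R) (m : ℕ) : Prop :=
  ∀ α : σ →₀ ℕ, α.degree < m → coeff α (shift a P) = 0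

theorem shift_neg_shift (a : σ → R) (P : MvPolynomial σ R) : shift (-a) (shift a P) = P := by
  have : (shift (-a)).comp (shift a) = AlgHom.id R (MvPolynomial σ R) := by
    ext i : 1
    simp [shift]
  exact DFunLike.congr_fun this P

theorem shift_ne_zero (a : σ → R) {P : MvPolynomial σ R} (hP : P ≠ 0) : shift a P ≠ 0 := by
  intro h
  apply hP
  rw [← shift_neg_shift a P, h, map_zero]

/-- Separates the shift in the distinguished variable from the shift in the others, which is what
induction on the number of variables needs. -/
theorem finSuccEquiv_shift {r : ℕ} (a₀ : R) (a : Fin r → R) (P : MvPolynomial (Fin (r + 1)) R) :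
    finSuccEquiv R r (shift (Fin.cons a₀ a) P) =
      Polynomial.taylor (C a₀) ((finSuccEquiv R r P).map (shift a : _ →+* _)) := by
  induction P using MvPolynomial.induction_on with
  | C c => simp [shift, finSuccEquiv_apply]
  | add p q hp hq => simp [hp, hq]
  | mul_X p i hp =>
    have hX : finSuccEquiv R r (shift (Fin.cons a₀ a) (X i)) =
        Polynomial.taylor (C a₀) ((finSuccEquiv R r (X i)).map (shift a : _ →+* _)) := by
      refine Fin.cases ?_ (fun j => ?_) i
      · rw [shift, aeval_X, map_add, finSuccEquiv_X_zero, Fin.cons_zero, Polynomial.map_X,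
          Polynomial.taylor_X, ← algebraMap_eq, AlgEquiv.commutes]
        rfl
      · rw [shift, aeval_X, map_add, finSuccEquiv_X_succ, Fin.cons_succ, Polynomial.map_C,
          Polynomial.taylor_C, ← algebraMap_eq, AlgEquiv.commutes, RingHom.coe_coe, shift, aeval_X,
          map_add]
        rfl
    rw [map_mul (shift _), map_mul (finSuccEquiv R r), hp, map_mul (finSuccEquiv R r),
      Polynomial.map_mul, Polynomial.taylor_mul, hX]

/-- The shift is by a constant, so it commutes with extracting the coefficient of `α`;
multiplicities can thus be read off a one-variable polynomial over the base ring. -/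
theorem coeff_coeff_taylor {N : ℕ} (a₀ : R) (α : σ →₀ ℕ) (f : Polynomial (MvPolynomial σ R))
    (hN : f.natDegree ≤ N) (k : ℕ) :
    coeff α ((Polynomial.taylor (C a₀) f).coeff k) =
      (Polynomial.taylor a₀ (∑ i ∈ Finset.range (N + 1),
        Polynomial.C (coeff α (f.coeff i)) * Polynomial.X ^ i)).coeff k := by
  conv_lhs => rw [f.as_sum_range_C_mul_X_pow' (Nat.lt_succ_of_le hN)]
  simp only [map_sum, Polynomial.taylor_mul, Polynomial.taylor_C, Polynomial.taylor_X_pow,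
    Polynomial.finsetSum_coeff, Polynomial.coeff_C_mul, Polynomial.coeff_X_add_C_pow, coeff_sum]
  refine Finset.sum_congr rfl fun i _ => ?_
  rw [← map_pow, ← map_natCast (C : R →+* MvPolynomial σ R), ← map_mul, mul_comm, coeff_C_mul, mul_comm]

/-- The Schwartz–Zippel lemma with multiplicities. -/
theorem card_mul_sum_order_le {F : Type*} [Field F] [Fintype F] {r : ℕ}
    {P : MvPolynomial (Fin r) F} (hP : P ≠ 0) (w : (Fin r → F) → ℕ)
    (hw : ∀ a, VanishesToOrder P a (w a)) :
    Fintype.card F * ∑ a, w a ≤ P.totalDegree * Fintype.card F ^ r := by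
  classical
  induction r with
  | zero =>
    have h0 : ∀ a, w a = 0 := by
      intro a
      by_contra h
      have := hw a 0 (by simpa using Nat.pos_of_ne_zero h)
      apply shift_ne_zero a hP
      ext α
      rw [Subsingleton.elim α 0, this, coeff_zero]
    simp [h0]
  | succ r ih =>
    set q := Fintype.card F
    set p := finSuccEquiv F r P with hp
    have hp0 : p ≠ 0 := by simpa [hp] using hP
    set t := p.natDegree
    have hl : p.coeff t ≠ 0 := by simpa [t] using hp0
    have hdeg : (p.coeff t).totalDegree + t ≤ P.totalDegree :=
      totalDegree_coeff_finSuccEquiv_add_le P t hl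
    -- `α` is a lowest-degree exponent of the leading coefficient expanded at `a`, so its degree is
    -- the exact order of vanishing there.
    have hex : ∀ a : Fin r → F, ∃ α : Fin r →₀ ℕ, coeff α (shift a (p.coeff t)) ≠ 0 ∧
        VanishesToOrder (p.coeff t) a α.degree := by
      intro a
      obtain ⟨α, hα, hmin⟩ := Finset.exists_min_image (shift a (p.coeff t)).support Finsupp.degree
        (support_nonempty.2 (shift_ne_zero a hl))
      refine ⟨α, by simpa using hα, fun β hβ => ?_⟩
      by_contra h
      exact absurd (hmin β (by simpa using h)) (not_le.2 hβ)
    choose α hα hαv using hex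
    have key : ∀ a : Fin r → F, ∑ a₀ : F, w (Fin.cons a₀ a) ≤ q * (α a).degree + t := by
      intro a
      set f := p.map (shift a : _ →+* MvPolynomial (Fin r) F) with hf
      have hft : f.natDegree ≤ t := Polynomial.natDegree_map_le
      -- The `α a`-slice of `P` along the line over `a`. It is nonzero of degree `t` by the choice
      -- of `α`, and its root multiplicities account for the orders of `P` up to a loss of `(α
      -- a).degree` per point.
      set Q := ∑ i ∈ Finset.range (t + 1),
        Polynomial.C (coeff (α a) (f.coeff i)) * Polynomial.X ^ i with hQ
      have hQt : Q.coeff t ≠ 0 := by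
        simpa [hQ, Polynomial.finsetSum_coeff, Polynomial.coeff_X_pow, hf] using hα a
      have hQ0 : Q ≠ 0 := by
        rintro h
        simp [h] at hQt
      have hQd : Q.natDegree ≤ t := by
        refine Polynomial.natDegree_sum_le_of_forall_le _ _ fun i hi => ?_
        exact (Polynomial.natDegree_C_mul_X_pow_le _ _).trans (by simpa [Nat.lt_succ_iff] using hi)
      have hroot : ∀ a₀ : F, w (Fin.cons a₀ a) ≤ (α a).degree + Q.rootMultiplicity a₀ := by
        intro a₀
        rw [← tsub_le_iff_left, Polynomial.le_rootMultiplicity_iff hQ0]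
        suffices h : Polynomial.X ^ (w (Fin.cons a₀ a) - (α a).degree) ∣ Polynomial.taylor a₀ Q by
          simpa [Polynomial.taylor_taylor, sub_eq_add_neg] using
            map_dvd (Polynomial.taylorAlgHom (-a₀)) h
        rw [Polynomial.X_pow_dvd_iff]
        intro k hk
        rw [hQ, ← coeff_coeff_taylor a₀ (α a) f hft k, hf, hp, ← finSuccEquiv_shift,
          finSuccEquiv_coeff_coeff]
        refine hw (Fin.cons a₀ a) _ ?_
        have : (Finsupp.cons k (α a)).degree = k + (α a).degree := by
          simp [Finsupp.degree_eq_sum, Fin.sum_univ_succ]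
        omega
      have hsum : ∑ a₀ : F, Q.rootMultiplicity a₀ ≤ t := by
        calc ∑ a₀ : F, Q.rootMultiplicity a₀ = ∑ a₀ : F, Q.roots.count a₀ := by
              simp [Polynomial.count_roots]
          _ = Multiset.card Q.roots := Multiset.sum_count_eq_card (by simp)
          _ ≤ Q.natDegree := Q.card_roots'
          _ ≤ t := hQd
      calc ∑ a₀ : F, w (Fin.cons a₀ a)
          ≤ ∑ a₀ : F, ((α a).degree + Q.rootMultiplicity a₀) :=
            Finset.sum_le_sum fun a₀ _ => hroot a₀
        _ ≤ q * (α a).degree + t := by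
            rw [Finset.sum_add_distrib]
            simpa [q] using hsum
    have hIH := ih hl (fun a => (α a).degree) hαv
    have hsplit : ∑ a, w a = ∑ a : Fin r → F, ∑ a₀ : F, w (Fin.cons a₀ a) := by
      rw [← (Fin.consEquiv fun _ => F).sum_comp, Fintype.sum_prod_type_right]
      rfl
    calc q * ∑ a, w a ≤ q * ∑ a : Fin r → F, (q * (α a).degree + t) := by
          rw [hsplit]
          exact Nat.mul_le_mul_left _ (Finset.sum_le_sum fun a _ => key a)
      _ = q * (q * ∑ a, (α a).degree) + t * q ^ (r + 1) := by
          rw [Finset.sum_add_distrib, ← Finset.mul_sum]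
          simp [q]
          ring
      _ ≤ q * ((p.coeff t).totalDegree * q ^ r) + t * q ^ (r + 1) := by gcongr
      _ = ((p.coeff t).totalDegree + t) * q ^ (r + 1) := by ring
      _ ≤ P.totalDegree * q ^ (r + 1) := by gcongr

end MvPolynomial

/-! ### Interpolation with multiplicities. -/

namespace MvPolynomial

/-- The exponents in `n` variables of degree less than `m`. -/
noncomputable def exponentsLT (n m : ℕ) : Finset (Fin n →₀ ℕ) :=
  (Finset.range m).biUnion fun k => Finset.finsuppAntidiag Finset.univ k

theorem mem_exponentsLT {n m : ℕ} {α : Fin n →₀ ℕ} : α ∈ exponentsLT n m ↔ α.degree < m := by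
  simp [exponentsLT, Finset.mem_finsuppAntidiag, Finsupp.degree_eq_sum]

theorem card_exponentsLT (n m : ℕ) : (exponentsLT n (m + 1)).card = (m + n).choose n := by
  classical
  rw [exponentsLT, Finset.card_biUnion, ← Nat.sum_range_multichoose]
  · refine Finset.sum_congr rfl fun k _ => ?_
    rw [Finset.card_finsuppAntidiag_nat_eq_multichoose, Finset.card_univ, Fintype.card_fin]
  · intro i _ j _ hij
    rw [Function.onFun, Finset.disjoint_left]
    intro α hα hβ
    simp only [Finset.mem_finsuppAntidiag] at hα hβ
    exact hij (hα.1.symm.trans hβ.1)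

/-- Bounds the number of linear conditions imposed by vanishing to order `m` at a point. The next
lemma bounds the number of free coefficients from below; the factor `n!` is common to both and
cancels. -/
theorem factorial_mul_card_exponentsLT_le (n m : ℕ) :
    n.factorial * (exponentsLT n m).card ≤ (m + n - 1) ^ n := by
  rcases m with _ | m
  · simp [exponentsLT]
  · rw [card_exponentsLT, ← Nat.descFactorial_eq_factorial_mul_choose]
    simpa [Nat.add_right_comm] using Nat.descFactorial_le_pow (m + n) n

theorem pow_le_factorial_mul_card_exponentsLT (n m : ℕ) :
    (m + 1) ^ n ≤ n.factorial * (exponentsLT n (m + 1)).card := by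
  rw [card_exponentsLT, ← Nat.descFactorial_eq_factorial_mul_choose]
  refine le_trans ?_ (Nat.pow_sub_le_descFactorial (m + n) n)
  gcongr
  omega

/-- Interpolation: a nonzero polynomial with prescribed orders of vanishing, by counting
coefficients. -/
theorem exists_vanishesToOrder {F ι : Type*} [Field F] [Fintype ι] {n d : ℕ}
    (pt : ι → Fin n → F) (w : ι → ℕ) (h : ∑ t, (w t + n - 1) ^ n < (d + 1) ^ n) :
    ∃ P : MvPolynomial (Fin n) F, P ≠ 0 ∧ P.totalDegree ≤ d ∧
      ∀ t, VanishesToOrder P (pt t) (w t) := by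
  classical
  let Φ : (exponentsLT n (d + 1) → F) →ₗ[F] MvPolynomial (Fin n) F :=
    ∑ α : exponentsLT n (d + 1), (monomial (α : Fin n →₀ ℕ)).comp (LinearMap.proj α)
  have hΦ : ∀ v, Φ v = ∑ α : exponentsLT n (d + 1), monomial (α : Fin n →₀ ℕ) (v α) := fun v => by simp [Φ]
  have hcoeff : ∀ v (α : exponentsLT n (d + 1)), coeff (α : Fin n →₀ ℕ) (Φ v) = v α := by
    intro v α
    simp [hΦ, coeff_sum, coeff_monomial]
  -- `Φ` builds a polynomial from its coefficients and `Ψ` collects all vanishing conditions; a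
  -- dimension count gives `Ψ` a nonzero kernel.
  let Ψ : (exponentsLT n (d + 1) → F) →ₗ[F] ((Σ t, exponentsLT n (w t)) → F) :=
    LinearMap.pi fun x =>
      (lcoeff F (x.2 : Fin n →₀ ℕ)).comp ((shift (pt x.1)).toLinearMap.comp Φ)
  have hcard : Module.finrank F ((Σ t, exponentsLT n (w t)) → F) <
      Module.finrank F (exponentsLT n (d + 1) → F) := by
    rw [Module.finrank_fintype_fun_eq_card, Module.finrank_fintype_fun_eq_card, Fintype.card_sigma]
    simp only [Fintype.card_coe]
    refine lt_of_mul_lt_mul_left (a := n.factorial) ?_ (Nat.zero_le _)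
    calc n.factorial * ∑ t, (exponentsLT n (w t)).card
        ≤ ∑ t, (w t + n - 1) ^ n := by
          rw [Finset.mul_sum]
          exact Finset.sum_le_sum fun t _ => factorial_mul_card_exponentsLT_le n (w t)
      _ < (d + 1) ^ n := h
      _ ≤ _ := pow_le_factorial_mul_card_exponentsLT n d
  obtain ⟨v, hv, hv0⟩ := (Submodule.ne_bot_iff _).1 (Ψ.ker_ne_bot_of_finrank_lt hcard)
  refine ⟨Φ v, ?_, ?_, fun t α hα => ?_⟩
  · intro h0
    apply hv0
    ext α
    rw [← hcoeff v α, h0, coeff_zero, Pi.zero_apply]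
  · rw [hΦ]
    refine totalDegree_finsetSum_le fun α _ => (totalDegree_monomial_le _ _).trans ?_
    have := mem_exponentsLT.1 α.2
    rw [Finsupp.degree_apply] at this
    exact Nat.lt_succ_iff.1 this
  · exact congrFun (LinearMap.mem_ker.1 hv) ⟨t, α, mem_exponentsLT.2 hα⟩

/-! ### Restriction of polynomials to affine flats. -/

section Restriction

variable {σ R : Type*} [CommRing R] {r : ℕ}

/-- The linear forms `∑ j, v j i * X j`. -/
noncomputable def linearForms (v : Fin r → σ → R) (i : σ) : MvPolynomial (Fin r) R :=
  ∑ j, C (v j i) * X j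

theorem isHomogeneous_linearForms (v : Fin r → σ → R) (i : σ) :
    (linearForms v i).IsHomogeneous 1 :=
  IsHomogeneous.sum _ _ _ fun j _ => isHomogeneous_C_mul_X _ j

/-- The pullback of a polynomial along the affine map `s ↦ y + ∑ j, s j • v j`. -/
noncomputable def restrictFlat (y : σ → R) (v : Fin r → σ → R) :
    MvPolynomial σ R →ₐ[R] MvPolynomial (Fin r) R :=
  aeval fun i => C (y i) + linearForms v i

theorem aeval_eq_sum {S : Type*} [CommRing S] [Algebra R S] (g : σ → S) (P : MvPolynomial σ R) :
    aeval g P = ∑ β ∈ P.support, algebraMap R S (coeff β P) * β.prod fun i k => g i ^ k := by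
  conv_lhs => rw [P.as_sum, map_sum]
  exact Finset.sum_congr rfl fun β _ => aeval_monomial _ _ _

/-- Expanding the restriction at `s` amounts to substituting homogeneous linear forms into the
expansion of `P` at the image point. This preserves degrees, so no terms of degree below `m` appear.
-/
theorem VanishesToOrder.restrictFlat {P : MvPolynomial σ R} {y : σ → R} {v : Fin r → σ → R}
    {s : Fin r → R} {m : ℕ} (h : VanishesToOrder P (y + ∑ j, s j • v j) m) :
    VanishesToOrder (restrictFlat y v P) s m := by
  have hcomm : shift s (MvPolynomial.restrictFlat y v P) =
      aeval (linearForms v) (shift (y + ∑ j, s j • v j) P) := by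
    have : (shift s).comp (MvPolynomial.restrictFlat y v) =
        (aeval (linearForms v)).comp (shift (y + ∑ j, s j • v j)) := by
      ext i : 1
      simp [shift, MvPolynomial.restrictFlat, linearForms, Finset.sum_apply, mul_add,
        Finset.sum_add_distrib, algebraMap_eq, mul_comm]
      ring
    exact DFunLike.congr_fun this P
  intro α hα
  rw [hcomm, aeval_eq_sum, coeff_sum]
  refine Finset.sum_eq_zero fun β hβ => ?_
  rw [algebraMap_eq, coeff_C_mul]
  have hβm : m ≤ β.degree := by
    by_contra hlt
    exact (mem_support_iff.1 hβ) (h β (not_le.1 hlt))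
  have hhom : (β.prod fun i k => linearForms v i ^ k).IsHomogeneous β.degree := by
    rw [Finsupp.degree_apply]
    refine IsHomogeneous.prod _ _ _ fun i _ => ?_
    simpa using (isHomogeneous_linearForms v i).pow (β i)
  rw [hhom.coeff_eq_zero (by omega), mul_zero]

theorem totalDegree_restrictFlat_le (y : σ → R) (v : Fin r → σ → R) (P : MvPolynomial σ R) :
    (restrictFlat y v P).totalDegree ≤ P.totalDegree := by
  rw [restrictFlat, aeval_eq_sum]
  refine totalDegree_finsetSum_le fun β hβ => ?_
  refine (totalDegree_mul _ _).trans ?_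
  rw [algebraMap_eq, totalDegree_C, zero_add]
  refine (totalDegree_finsetProd _ _).trans (le_trans ?_ (le_totalDegree hβ))
  refine Finset.sum_le_sum fun i _ => (totalDegree_pow _ _).trans ?_
  calc β i * (C (y i) + linearForms v i).totalDegree ≤ β i * 1 := by
        gcongr
        refine (totalDegree_add _ _).trans (max_le (by simp) ?_)
        exact (isHomogeneous_linearForms v i).totalDegree_le
    _ = β i := mul_one _

end Restriction

/-! ### The top-degree form as the value at infinity. -/

section TopForm

variable {σ R K : Type*} [CommRing R] [CommRing K] [Algebra R K]

theorem _root_.Polynomial.coeff_finsetProd_sum_of_natDegree_le {ι : Type*} (s : Finset ι)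
    (f : ι → Polynomial K) (e : ι → ℕ) (h : ∀ i ∈ s, (f i).natDegree ≤ e i) :
    (∏ i ∈ s, f i).natDegree ≤ ∑ i ∈ s, e i ∧
      (∏ i ∈ s, f i).coeff (∑ i ∈ s, e i) = ∏ i ∈ s, (f i).coeff (e i) := by
  classical
  induction s using Finset.induction_on with
  | empty => simp
  | insert a s ha ih =>
    obtain ⟨h1, h2⟩ := ih fun i hi => h i (Finset.mem_insert_of_mem hi)
    have h3 := h a (Finset.mem_insert_self a s)
    rw [Finset.prod_insert ha, Finset.sum_insert ha, Finset.prod_insert ha]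
    exact ⟨Polynomial.natDegree_mul_le_of_le h3 h1, by
      rw [Polynomial.coeff_mul_add_eq_of_natDegree_le h3 h1, h2]⟩

/-- The coefficient of `T ^ d` in `P(y + T x)`, for `P` of degree at most `d`, is the value at `x`
of the degree `d` part of `P`. -/
theorem coeff_aeval_line {P : MvPolynomial σ R} {d : ℕ} (hP : P.totalDegree ≤ d) (y x : σ → K) :
    (aeval (fun i => Polynomial.C (y i) + Polynomial.C (x i) * Polynomial.X) P).coeff d =
      aeval x (homogeneousComponent d P) := by
  classical
  have hlin : ∀ i k, ((Polynomial.C (y i) + Polynomial.C (x i) * Polynomial.X) ^ k).natDegree ≤ k ∧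
      ((Polynomial.C (y i) + Polynomial.C (x i) * Polynomial.X) ^ k).coeff k = x i ^ k := by
    intro i k
    have h1 : (Polynomial.C (y i) + Polynomial.C (x i) * Polynomial.X).natDegree ≤ 1 := by
      rw [add_comm]
      exact Polynomial.natDegree_linear_le
    refine ⟨by simpa using Polynomial.natDegree_pow_le_of_le k h1, ?_⟩
    have := Polynomial.coeff_pow_of_natDegree_le (m := k) h1
    simpa [Polynomial.coeff_C] using this
  rw [aeval_eq_sum, Polynomial.finsetSum_coeff, homogeneousComponent_apply, map_sum,
    Finset.sum_filter]
  refine Finset.sum_congr rfl fun β hβ => ?_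
  obtain ⟨h1, h2⟩ := Polynomial.coeff_finsetProd_sum_of_natDegree_le β.support
    (fun i => (Polynomial.C (y i) + Polynomial.C (x i) * Polynomial.X) ^ β i) β
    (fun i _ => (hlin i _).1)
  rw [IsScalarTower.algebraMap_apply R K (Polynomial K), Polynomial.algebraMap_apply,
    Algebra.algebraMap_self_apply, Polynomial.coeff_C_mul, aeval_monomial]
  split_ifs with hd
  · rw [Finsupp.degree_apply] at hd
    rw [Finsupp.prod, ← hd, h2]
    simp only [(hlin _ _).2]
    rfl
  · rw [Finsupp.prod, Polynomial.coeff_eq_zero_of_natDegree_lt, mul_zero]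
    refine lt_of_le_of_lt h1 (lt_of_le_of_ne ((le_totalDegree hβ).trans hP) ?_)
    rwa [Finsupp.degree_apply] at hd

/-- If `P` vanishes identically on the flat `y + span v` then its top form vanishes at every
combination of the `v j` with coefficients in an extension. -/
theorem aeval_homogeneousComponent_eq_zero {r d : ℕ} {P : MvPolynomial σ R}
    (hP : P.totalDegree ≤ d) {y : σ → R} {v : Fin r → σ → R} (h : restrictFlat y v P = 0)
    (θ : Fin r → K) :
    aeval (fun i => ∑ j, algebraMap R K (v j i) * θ j) (homogeneousComponent d P) = 0 := by
  -- The line through `y` in direction `∑ j, θ j • v j` lies in the flat after extension of scalars,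
  -- so `P` is identically zero along it.
  rw [← coeff_aeval_line hP (fun i => algebraMap R K (y i))]
  have : aeval (fun i => Polynomial.C (algebraMap R K (y i)) +
      Polynomial.C (∑ j, algebraMap R K (v j i) * θ j) * Polynomial.X) P =
      aeval (fun j => Polynomial.C (θ j) * Polynomial.X) (restrictFlat y v P) := by
    have hc : (aeval fun j => Polynomial.C (θ j) * Polynomial.X).comp (restrictFlat y v) =
        aeval (R := R) fun i => Polynomial.C (algebraMap R K (y i)) +
      Polynomial.C (∑ j, algebraMap R K (v j i) * θ j) * Polynomial.X := by
      ext i : 1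
      simp [restrictFlat, linearForms, Finset.sum_mul, mul_assoc,
        IsScalarTower.algebraMap_apply R K (Polynomial K)]
    exact (DFunLike.congr_fun hc P).symm
  rw [this, h, map_zero, Polynomial.coeff_zero]

theorem homogeneousComponent_totalDegree_ne_zero {P : MvPolynomial σ R} (hP : P ≠ 0) :
    homogeneousComponent P.totalDegree P ≠ 0 := by
  classical
  obtain ⟨β, hβ, hd⟩ := Finset.exists_mem_eq_sup P.support (support_nonempty.2 hP)
    (fun s => s.sum fun _ e => e)
  intro h
  have := coeff_homogeneousComponent P.totalDegree P β
  rw [h, if_pos (by rw [totalDegree, hd, Finsupp.degree_apply, Finsupp.sum]), coeff_zero] at this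
  exact mem_support_iff.1 hβ this.symm

end TopForm

end MvPolynomial

/-! ### Counting directions of heavy flats over `𝔽_{p^r}`. -/

namespace SmoothCover

open MvPolynomial

/-- At least half of all `r`-tuples are independent. The induction proves the stronger `∏_{i<k} (1 -
q^i / q^n) ≥ 1 - q^k / (2 q^n)`, whose step uses `q ≥ 3`. -/
theorem pow_mul_le_two_mul_prod {q n r : ℕ} (hq : 3 ≤ q) (hr : r ≤ n) :
    q ^ (n * r) ≤ 2 * ∏ i : Fin r, (q ^ n - q ^ (i : ℕ)) := by
  have hq1 : 1 ≤ q := by omega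
  have key : ∀ k ≤ n, (2 * (q : ℝ) ^ n - q ^ k) * ((q : ℝ) ^ n) ^ k ≤
      2 * (q : ℝ) ^ n * ∏ i ∈ Finset.range k, ((q : ℝ) ^ n - (q : ℝ) ^ i) := by
    intro k
    induction k with
    | zero => intro _; simp
    | succ k ih =>
      intro hk
      have h := ih (by omega)
      rw [Finset.prod_range_succ]
      have hc : (q : ℝ) ^ k ≤ (q : ℝ) ^ n :=
        pow_le_pow_right₀ (by exact_mod_cast hq1) (by omega)
      have hM : 0 < ((q : ℝ) ^ n) ^ k := by positivity
      have hc0 : 0 < (q : ℝ) ^ k := by positivity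
      have hM0 : 0 < (q : ℝ) ^ n := by positivity
      have hq3 : (3 : ℝ) ≤ q := by exact_mod_cast hq
      have h1 := mul_le_mul_of_nonneg_right h (sub_nonneg.2 hc)
      rw [pow_succ, pow_succ]
      generalize (q : ℝ) ^ n = M at *
      generalize (q : ℝ) ^ k = c at *
      have h2 : 0 ≤ M ^ k * (c ^ 2 + (q - 3) * c * M) :=
        mul_nonneg hM.le (by have := mul_nonneg (mul_nonneg (sub_nonneg.2 hq3) hc0.le) hM0.le
                             positivity)
      nlinarith [h1, h2]
  have h := key r hr
  have hle : (q : ℝ) ^ r ≤ (q : ℝ) ^ n := pow_le_pow_right₀ (by exact_mod_cast hq1) hr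
  have hM0 : 0 < (q : ℝ) ^ n := by positivity
  have h2 : (q : ℝ) ^ n * ((q : ℝ) ^ n) ^ r ≤
      (q : ℝ) ^ n * (2 * ∏ i ∈ Finset.range r, ((q : ℝ) ^ n - (q : ℝ) ^ i)) := by
    refine le_trans ?_ (h.trans_eq (by ring))
    gcongr
    linarith
  have h3 := le_of_mul_le_mul_left h2 hM0
  have hcast : ((∏ i : Fin r, (q ^ n - q ^ (i : ℕ)) : ℕ) : ℝ) =
      ∏ i ∈ Finset.range r, ((q : ℝ) ^ n - (q : ℝ) ^ i) := by
    rw [← Fin.prod_univ_eq_prod_range (fun i => (q : ℝ) ^ n - (q : ℝ) ^ i), Nat.cast_prod]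
    refine Finset.prod_congr rfl fun i _ => ?_
    rw [Nat.cast_sub (Nat.pow_le_pow_right hq1 (by omega))]
    push_cast
    rfl
  rw [← Nat.cast_le (α := ℝ), Nat.cast_mul, hcast, pow_mul]
  push_cast
  exact h3

variable {n r p : ℕ} [Fact p.Prime]

/-- The number of bases of a subspace in a family of `r`-dimensional subspaces, summed over the
family. -/
theorem ncard_independent_tuples (T : Set (Submodule (ZMod p) (Fin n → ZMod p)))
    (hT : T ⊆ grassmannian n r p) :
    {v : Fin r → Fin n → ZMod p | LinearIndependent (ZMod p) v ∧
      Submodule.span (ZMod p) (Set.range v) ∈ T}.ncard =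
      T.ncard * ∏ i : Fin r, (p ^ r - p ^ (i : ℕ)) := by
  classical
  have hfib : ∀ S : T, Nat.card {v : Fin r → Fin n → ZMod p // LinearIndependent (ZMod p) v ∧
      Submodule.span (ZMod p) (Set.range v) = S} = ∏ i : Fin r, (p ^ r - p ^ (i : ℕ)) := by
    intro S
    have hS : Module.finrank (ZMod p) (S : Submodule (ZMod p) (Fin n → ZMod p)) = r := hT S.2
    have h := card_linearIndependent (K := ZMod p)
      (V := (S : Submodule (ZMod p) (Fin n → ZMod p))) (k := r) hS.ge
    rw [ZMod.card, hS] at h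
    rw [← h]
    refine Nat.card_congr ⟨fun v => ⟨fun i => ⟨v.1 i, ?_⟩, ?_⟩, fun v => ⟨fun i => v.1 i, ?_, ?_⟩,
      fun v => rfl, fun v => rfl⟩
    · exact v.2.2.le (Submodule.subset_span ⟨i, rfl⟩)
    · exact LinearIndependent.of_comp (Submodule.subtype _) v.2.1
    · exact v.2.map' (Submodule.subtype _) (Submodule.ker_subtype _)
    · refine Submodule.eq_of_le_of_finrank_eq ?_ ?_
      · rw [Submodule.span_le]
        rintro _ ⟨i, rfl⟩
        exact (v.1 i).2
      · exact (finrank_span_eq_card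
          (v.2.map' (Submodule.subtype _) (Submodule.ker_subtype _))).trans
          ((Fintype.card_fin r).trans hS.symm)
  rw [← Nat.card_coe_set_eq, ← Nat.card_coe_set_eq]
  have e : {v : Fin r → Fin n → ZMod p | LinearIndependent (ZMod p) v ∧
      Submodule.span (ZMod p) (Set.range v) ∈ T} ≃ Σ S : T, {v : Fin r → Fin n → ZMod p //
        LinearIndependent (ZMod p) v ∧ Submodule.span (ZMod p) (Set.range v) = S} :=
    ⟨fun v => ⟨⟨_, v.2.2⟩, ⟨v.1, v.2.1, rfl⟩⟩, fun x => ⟨x.2.1, x.2.2.1, by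
      rw [x.2.2.2]; exact x.1.2⟩, fun v => rfl, by
      rintro ⟨⟨S, hS⟩, ⟨v, hv, h⟩⟩
      obtain rfl : Submodule.span (ZMod p) (Set.range v) = S := h
      rfl⟩
  rw [Nat.card_congr e, Nat.card_sigma]
  simp only [hfib]
  simp [Finset.sum_const, Nat.card_eq_fintype_card]

theorem ncard_grassmannian_pos (hr : r ≤ n) : 0 < (grassmannian n r p).ncard := by
  rw [Set.ncard_pos]
  obtain ⟨v, hv⟩ := exists_linearIndependent_of_le_finrank (R := ZMod p) (M := Fin n → ZMod p)
    (by simpa using hr)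
  exact ⟨_, (finrank_span_eq_card hv).trans (Fintype.card_fin r)⟩

/-- The polynomial method: if `w` has small `ℓⁿ` norm, then few directions `S` admit a translate on
which `w` is large on average. -/
theorem ncard_heavy_flats_le (hp : 3 ≤ p) (hr0 : r ≠ 0) (hr : r ≤ n) {d : ℕ}
    (w : (Fin n → ZMod p) → ℕ) (hw : ∑ a, (w a + n - 1) ^ n < (d + 1) ^ n) :
    {S ∈ grassmannian n r p | ∃ y, d * p ^ r < p * ∑ᶠ s : S, w (y + s)}.ncard * p ^ r ≤
      2 * d * (grassmannian n r p).ncard := by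
  classical
  set Bad := {S ∈ grassmannian n r p | ∃ y, d * p ^ r < p * ∑ᶠ s : S, w (y + s)}
  obtain ⟨P, hP0, hPd, hPv⟩ := exists_vanishesToOrder (F := ZMod p) id w hw
  let K := GaloisField p r
  have : Fintype K := Fintype.ofFinite K
  have hK : Fintype.card K = p ^ r := by
    rw [← Nat.card_eq_fintype_card, GaloisField.card p r hr0]
  let θ : Module.Basis (Fin r) (ZMod p) K := Module.finBasisOfFinrankEq _ _ (GaloisField.finrank p hr0)
  set Q := map (algebraMap (ZMod p) K) (homogeneousComponent P.totalDegree P) with hQ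
  have hQ0 : Q ≠ 0 := by
    rw [hQ, Ne, map_eq_zero_iff _ (map_injective _ (algebraMap (ZMod p) K).injective)]
    exact homogeneousComponent_totalDegree_ne_zero hP0
  have hQd : Q.totalDegree ≤ d :=
    ((homogeneousComponent_isHomogeneous _ _).map _).totalDegree_le.trans hPd
  have hSZ := schwartz_zippel_totalDegree hQ0 (Finset.univ : Finset K)
  set Z := (Finset.univ : Finset (Fin n → K)).filter fun f => eval f Q = 0 with hZ
  have hZ' : Z.card * p ^ r ≤ d * p ^ (n * r) := by
    have hpos : (0 : ℚ≥0) < (p : ℚ≥0) ^ r := by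
      have : (0 : ℚ≥0) < p := by exact_mod_cast (by omega : 0 < p)
      positivity
    simp only [Fintype.piFinset_univ, Finset.card_univ, hK, Nat.cast_pow] at hSZ
    rw [div_le_div_iff₀ (by positivity) hpos, ← pow_mul, mul_comm r n] at hSZ
    have h2 : Z.card * p ^ r ≤ Q.totalDegree * p ^ (n * r) := by exact_mod_cast hSZ
    exact h2.trans (Nat.mul_le_mul_right _ hQd)
  -- Reading `r` vectors over `𝔽_p` as the `θ`-coordinates of one vector over `𝔽_{p^r}` injects the
  -- bases of bad subspaces into the zeros of the top form.
  have hle : {v : Fin r → Fin n → ZMod p | LinearIndependent (ZMod p) v ∧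
      Submodule.span (ZMod p) (Set.range v) ∈ Bad}.ncard ≤ Z.card := by
    rw [← Set.ncard_coe_finset]
    refine Set.ncard_le_ncard_of_injOn
      (fun v i => ∑ j, algebraMap (ZMod p) K (v j i) * θ j) ?_ ?_ (Set.toFinite _)
    · rintro v ⟨hv, -, y, hy⟩
      simp only [hZ, Finset.coe_filter, Finset.mem_univ, true_and, Set.mem_ofPred_eq]
      rw [hQ, eval_map, ← aeval_def]
      refine aeval_homogeneousComponent_eq_zero le_rfl (y := y) ?_ θ
      -- If `P` did not vanish on the flat, Schwartz–Zippel with multiplicities would bound the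
      -- weight of the flat and contradict its heaviness.
      by_contra hne
      have h := card_mul_sum_order_le hne (fun s => w (y + ∑ j, s j • v j))
        fun s => (hPv _).restrictFlat
      rw [ZMod.card] at h
      have hsum : ∑ᶠ s : Submodule.span (ZMod p) (Set.range v), w (y + s) =
          ∑ s : Fin r → ZMod p, w (y + ∑ j, s j • v j) := by
        rw [finsum_eq_sum_of_fintype]
        refine (Fintype.sum_equiv (Module.Basis.span hv).equivFun.symm.toEquiv _ _ fun s => ?_).symm
        simp [Module.Basis.span_apply]
      rw [hsum] at hy
      have := h.trans (Nat.mul_le_mul_right _ ((totalDegree_restrictFlat_le y v P).trans hPd))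
      omega
    · intro v _ v' _ h
      ext j i
      have hi := congrFun h i
      simp only [← Algebra.smul_def] at hi
      exact congrFun (θ.linearIndependent.fintypeLinearCombination_injective
        (a₁ := fun j => v j i) (a₂ := fun j => v' j i) hi) j
  have hBad := ncard_independent_tuples Bad (fun S hS => hS.1)
  have hall := ncard_independent_tuples (grassmannian n r p) (le_refl _)
  have htot : {v : Fin r → Fin n → ZMod p | LinearIndependent (ZMod p) v ∧
      Submodule.span (ZMod p) (Set.range v) ∈ grassmannian n r p}.ncard =
      ∏ i : Fin r, (p ^ n - p ^ (i : ℕ)) := by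
    have h := card_linearIndependent (K := ZMod p) (V := Fin n → ZMod p) (k := r) (by simpa using hr)
    rw [ZMod.card, Module.finrank_fin_fun] at h
    rw [← h, ← Nat.card_coe_set_eq]
    refine Nat.card_congr (Equiv.subtypeEquivRight fun v => ⟨fun h => h.1, fun h => ⟨h, ?_⟩⟩)
    exact (finrank_span_eq_card h).trans (Fintype.card_fin r)
  have hprod := pow_mul_le_two_mul_prod hp hr
  set N := ∏ i : Fin r, (p ^ r - p ^ (i : ℕ))
  have hN : 0 < N := 
    Finset.prod_pos fun i _ => Nat.sub_pos_of_lt (Nat.pow_lt_pow_right (by omega) i.2)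
  refine le_of_mul_le_mul_right ?_ hN
  calc Bad.ncard * p ^ r * N = Bad.ncard * N * p ^ r := by ring
    _ ≤ Z.card * p ^ r := by
      rw [← hBad]
      exact Nat.mul_le_mul_right _ hle
    _ ≤ d * p ^ (n * r) := hZ'
    _ ≤ d * (2 * ∏ i : Fin r, (p ^ n - p ^ (i : ℕ))) := Nat.mul_le_mul_left _ hprod
    _ = 2 * d * (grassmannian n r p).ncard * N := by
      rw [← htot, hall]
      ring

end SmoothCover

/-! ### Equidistribution of a set over the translates of a random subspace. -/

namespace SmoothCover

/-- `h` is the integer amplitude of the weight perturbation. The last bound keeps the lowered weight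
positive, so that truncated subtraction is true subtraction. -/
theorem exists_weights_parameters {n r p : ℕ} {τ : ℝ} (hn : 1 ≤ n) (hr : 3 ≤ r)
    (hτ0 : 0 < τ) (hτ1 : τ < 1) (hp : 64 * n < p * τ ^ 2) :
    ∃ h : ℕ, τ * p ^ (r - 2) / 4 ≤ h ∧ (h : ℝ) ≤ τ * p ^ (r - 2) / 2 ∧
      h + n ≤ n * p ^ (r - 2) := by
  have hn' : (1 : ℝ) ≤ n := by exact_mod_cast hn
  have hpτ : 64 * n < p * τ := by nlinarith
  have hp1 : 64 * (n : ℝ) < p := by nlinarith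
  have hp1' : (1 : ℝ) ≤ p := by linarith
  have hple : (p : ℝ) ≤ p ^ (r - 2) := le_self_pow₀ hp1' (by omega)
  generalize hQ : (p : ℝ) ^ (r - 2) = Q at *
  have hτQ : 64 ≤ τ * Q := by nlinarith
  refine ⟨⌊τ * Q / 2⌋₊, ?_, Nat.floor_le (by positivity), ?_⟩
  · have := Nat.lt_floor_add_one (τ * Q / 2)
    linarith
  · have := Nat.floor_le (show 0 ≤ τ * Q / 2 by positivity)
    have h2 : ((⌊τ * Q / 2⌋₊ + n : ℕ) : ℝ) ≤ ((n * p ^ (r - 2) : ℕ) : ℝ) := by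
      push_cast
      rw [hQ]
      nlinarith
    exact_mod_cast h2

theorem one_add_pow_le {n : ℕ} {x : ℝ} (hx : |n * x| ≤ 1) (hx1 : -1 ≤ x) :
    (1 + x) ^ n ≤ 1 + n * x + (n * x) ^ 2 := by
  have h1 : (1 + x) ^ n ≤ Real.exp (n * x) := by
    rw [Real.exp_nat_mul]
    exact pow_le_pow_left₀ (by linarith) (by linarith [Real.add_one_le_exp x]) n
  have h2 := (abs_le.1 (Real.abs_exp_sub_one_sub_id_le hx)).2
  linarith

theorem abs_mul_add_sq_le {a μ x : ℝ} (ha : 1 ≤ a) (hμ0 : 0 ≤ μ) (hμ1 : μ ≤ 1)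
    (hx : |a * x| ≤ 1 / 2) : |μ * (x + a * x ^ 2)| ≤ 1 := by
  have h1 : |x| ≤ |a * x| := by
    rw [abs_mul, abs_of_nonneg (by linarith : 0 ≤ a)]
    exact le_mul_of_one_le_left (abs_nonneg x) ha
  calc |μ * (x + a * x ^ 2)| = μ * |x + a * x * x| := by
        rw [abs_mul, abs_of_nonneg hμ0]
        ring_nf
    _ ≤ 1 * (|x| + |a * x| * |x|) := by
        gcongr
        exact (abs_add_le _ _).trans_eq (by rw [abs_mul (a * x)])
    _ ≤ 1 := by nlinarith [abs_nonneg x, abs_nonneg (a * x)]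

theorem sum_ite_mem {ι : Type*} [Fintype ι] (A : Set ι) [DecidablePred (· ∈ A)] (a b : ℝ) :
    ∑ i, (if i ∈ A then a else b) = b * Fintype.card ι + (a - b) * A.ncard := by
  have h : ∀ i, (if i ∈ A then a else b) = b + (a - b) * if i ∈ A then 1 else 0 := by
    intro i
    split_ifs <;> ring
  simp only [h, Finset.sum_add_distrib, ← Finset.mul_sum, Finset.sum_boole]
  rw [Set.ncard_eq_toFinset_card', ← Set.filter_mem_univ_eq_toFinset]
  simp [mul_comm]

variable {n r p : ℕ} [Fact p.Prime]

theorem finsum_ite_mem (A : Set (Fin n → ZMod p)) [DecidablePred (· ∈ A)]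
    {S : Submodule (ZMod p) (Fin n → ZMod p)} (hS : S ∈ grassmannian n r p) (y : Fin n → ZMod p)
    (C₁ C₀ : ℕ) :
    ((∑ᶠ s : S, if -y + (s : Fin n → ZMod p) ∈ A then C₁ else C₀ : ℕ) : ℝ) =
      C₀ * p ^ r + ((C₁ : ℝ) - C₀) * {a ∈ A | a + y ∈ S}.ncard := by
  classical
  have hcard : Fintype.card S = p ^ r := by
    rw [Module.card_eq_pow_finrank (K := ZMod p), ZMod.card]
    exact congrArg _ hS
  rw [finsum_eq_sum_of_fintype]
  have h := sum_ite_mem {s : S | -y + (s : Fin n → ZMod p) ∈ A} (C₁ : ℝ) C₀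
  rw [hcard] at h
  have hN : {s : S | -y + (s : Fin n → ZMod p) ∈ A}.ncard = {a ∈ A | a + y ∈ S}.ncard := by
    rw [← Nat.card_coe_set_eq, ← Nat.card_coe_set_eq]
    refine Nat.card_congr ⟨fun s => ⟨-y + s.1, s.2, by simp⟩,
      fun a => ⟨⟨a.1 + y, a.2.2⟩, by simpa using a.2.1⟩, fun s => ?_, fun a => ?_⟩
    · ext1; ext1; simp
    · ext1; simp
  rw [hN] at h
  push_cast at h ⊢
  exact h

set_option maxHeartbeats 400000 in
/-- For most directions `S`, every translate of `S` meets the set `A` in about the expected number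
of points; `ε = 1` gives the upper bound and `ε = -1` the lower bound. -/
theorem ncard_unbalanced_lt {δ τ ε : ℝ} (hn : 1 ≤ n) (hr3 : 3 ≤ r) (hr : r ≤ n)
    (hδ : δ ∈ Set.Ioo (0 : ℝ) 1) (hτ : τ ∈ Set.Ioo (0 : ℝ) 1)
    (hp : (p : ℝ) > 64 * (n : ℝ) / (τ * δ) ^ 2) (hε : ε = 1 ∨ ε = -1)
    (A : Set (Fin n → ZMod p)) (hA : (p : ℝ) ^ n * p ^ 3 ≤ A.ncard * p ^ r) :
    (({S ∈ grassmannian n r p | ∃ y, τ * (A.ncard * p ^ r) <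
      ε * ({a ∈ A | a + y ∈ S}.ncard * p ^ n - A.ncard * p ^ r)}.ncard : ℕ) : ℝ) <
      δ * (grassmannian n r p).ncard := by
  classical
  obtain ⟨hδ0, hδ1⟩ := hδ
  obtain ⟨hτ0, hτ1⟩ := hτ
  have hn' : (1 : ℝ) ≤ n := by exact_mod_cast hn
  have hpδτ : 64 * n < p * (τ * δ) ^ 2 := by rwa [gt_iff_lt, div_lt_iff₀ (by positivity)] at hp
  have hpτ2 : 64 * n < p * τ ^ 2 := by
    refine hpδτ.trans_le ?_
    gcongr
    nlinarith
  have hpδ : 64 * n < p * δ := by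
    refine hpδτ.trans_le ?_
    gcongr
    have h1 : τ * δ ≤ δ := by nlinarith
    nlinarith [mul_pos hτ0 hδ0]
  have hpn : 64 * (n : ℝ) < p := by nlinarith
  have hp0 : (0 : ℝ) < p := by linarith
  have hp3 : 3 ≤ p := by
    have : ((3 : ℕ) : ℝ) ≤ p := by push_cast; linarith
    exact_mod_cast this
  have hε2 : ε ^ 2 = 1 := by rcases hε with rfl | rfl <;> norm_num
  have hε1 : |ε| = 1 := by rcases hε with rfl | rfl <;> norm_num
  obtain ⟨h, hh1, hh2, hh3⟩ := exists_weights_parameters (p := p) hn hr3 hτ0 hτ1 hpτ2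
  -- `C₀` is chosen to absorb the `n - 1` of the interpolation bound: `w + n - 1` equals `Q` off `A`
  -- and `Q + ε h` on `A`.
  set Q := n * p ^ (r - 2) with hQ
  set C₀ := Q - (n - 1) with hC₀
  obtain ⟨C₁, hC₁⟩ : ∃ C₁ : ℕ, (C₁ : ℝ) = C₀ + ε * h := by
    rcases hε with rfl | rfl
    · exact ⟨C₀ + h, by push_cast; ring⟩
    · exact ⟨C₀ - h, by rw [Nat.cast_sub (by omega)]; ring⟩
  have hC₀' : (C₀ : ℝ) + (n - 1) = Q := by
    have : C₀ + (n - 1) = Q := by omega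
    rw [← this, Nat.cast_add, Nat.cast_sub hn, Nat.cast_one]
  set q : ℝ := (p : ℝ) ^ (r - 2) with hq
  have hQq : (Q : ℝ) = n * q := by simp [hQ, hq]
  have hq0 : 0 < q := by positivity
  have hQ0 : (0 : ℝ) < Q := by rw [hQq]; positivity
  have hpr : (p : ℝ) ^ r = q * p ^ 2 := by rw [hq, ← pow_add]; congr 1; omega
  set μ : ℝ := A.ncard / (p : ℝ) ^ n with hμ
  have hAμ : (A.ncard : ℝ) = μ * p ^ n := by rw [hμ]; field_simp
  have hμ0 : 0 ≤ μ := by positivity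
  have hμ1 : μ ≤ 1 := by
    rw [hμ, div_le_one (by positivity)]
    have := Set.ncard_le_card A
    rw [Nat.card_eq_fintype_card, Fintype.card_fun, ZMod.card, Fintype.card_fin] at this
    exact_mod_cast this
  -- The largeness of `A` enters here: the cube in `hA` leaves one factor `p` after dividing by
  -- `p²`, and this factor beats the error `n - 1` below.
  have hμq : p ≤ μ * q := by
    rw [hAμ, hpr] at hA
    refine le_of_mul_le_mul_left ?_ (show (0 : ℝ) < p ^ n * p ^ 2 by positivity)
    linarith
  set x : ℝ := ε * h / Q with hx
  have hh0 : (0 : ℝ) ≤ h := by positivity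
  have hxQ : Q * x = ε * h := by rw [hx]; field_simp
  have habs : |n * x| ≤ τ / 2 := by
    have : n * x = ε * (h / q) := by rw [hx, hQq]; field_simp
    rw [this, abs_mul, hε1, one_mul, abs_of_nonneg (by positivity), div_le_iff₀ hq0]
    linarith
  have hnx1 : |n * x| ≤ 1 := by linarith
  have hx1 : -1 ≤ x := by
    have : |x| ≤ |n * x| := by
      rw [abs_mul, Nat.abs_cast]
      exact le_mul_of_one_le_left (abs_nonneg x) hn'
    exact (abs_le.1 (this.trans hnx1)).1
  -- Chosen so that the mean of `(1 + x)ⁿ` on `A` and `1` off `A` is at most `1 + n ξ`, hence at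
  -- most `(1 + ξ)ⁿ` by Bernoulli.
  set ξ : ℝ := μ * (x + n * x ^ 2) with hξ
  have hnξ : n * ξ = μ * (n * x + (n * x) ^ 2) := by rw [hξ]; ring
  have hξabs := abs_le.1 (abs_mul_add_sq_le hn' hμ0 hμ1 (x := x) (by linarith))
  have hξ1 : ξ ≤ 1 := hξabs.2
  have hξ0 : 0 ≤ 1 + ξ := by linarith [hξabs.1]
  have hξ2 : -2 ≤ ξ := by linarith
  set d := ⌊p * Q * (1 + ξ)⌋₊ with hd
  have hdle : (d : ℝ) ≤ p * Q * (1 + ξ) := Nat.floor_le (by positivity)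
  have hdlt : p * Q * (1 + ξ) < d + 1 := Nat.lt_floor_add_one _
  let w : (Fin n → ZMod p) → ℕ := fun a => if a ∈ A then C₁ else C₀
  have hw : ∑ a, (w a + n - 1) ^ n < (d + 1) ^ n := by
    have hcast : ∀ a, (((w a + n - 1 : ℕ) : ℝ)) ^ n =
        if a ∈ A then ((Q : ℝ) * (1 + x)) ^ n else (Q : ℝ) ^ n := by
      intro a
      rw [Nat.cast_sub (by omega)]
      push_cast
      by_cases ha : a ∈ A
      · simp only [w, ha, if_true]
        congr 1
        rw [hC₁, mul_add, hxQ]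
        linarith
      · simp only [w, ha, if_false]
        congr 1
        linarith
    have : ((∑ a, (w a + n - 1) ^ n : ℕ) : ℝ) < ((d + 1 : ℕ) : ℝ) ^ n := by
      rw [Nat.cast_sum]
      simp only [Nat.cast_pow]
      simp only [hcast]
      rw [sum_ite_mem, Fintype.card_fun, ZMod.card, Fintype.card_fin, hAμ, mul_pow]
      calc (Q : ℝ) ^ n * ((p ^ n : ℕ) : ℝ) + ((Q : ℝ) ^ n * (1 + x) ^ n - (Q : ℝ) ^ n) * (μ * p ^ n)
          = (p * Q) ^ n * (1 + μ * ((1 + x) ^ n - 1)) := by push_cast; ring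
        _ ≤ (p * Q) ^ n * (1 + n * ξ) := by
          rw [hnξ]
          gcongr
          linarith [one_add_pow_le (n := n) hnx1 hx1]
        _ ≤ (p * Q) ^ n * (1 + ξ) ^ n := by
          gcongr
          exact one_add_mul_le_pow hξ2 n
        _ = (p * Q * (1 + ξ)) ^ n := (mul_pow _ _ _).symm
        _ < ((d + 1 : ℕ) : ℝ) ^ n := by
          push_cast
          exact pow_lt_pow_left₀ hdlt (by positivity) (by omega)
    exact_mod_cast this
  have hmain := ncard_heavy_flats_le hp3 (by omega) hr w hw
  have hsub : {S ∈ grassmannian n r p | ∃ y, τ * (A.ncard * p ^ r) <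
      ε * ({a ∈ A | a + y ∈ S}.ncard * p ^ n - A.ncard * p ^ r)} ⊆
      {S ∈ grassmannian n r p | ∃ y, d * p ^ r < p * ∑ᶠ s : S, w (y + s)} := by
    rintro S ⟨hS, y, hy⟩
    refine ⟨hS, -y, ?_⟩
    rw [← Nat.cast_lt (α := ℝ)]
    rw [Nat.cast_mul (p : ℕ) (∑ᶠ s : S, w (-y + s)), finsum_ite_mem A hS y C₁ C₀, hC₁]
    set N : ℝ := ({a ∈ A | a + y ∈ S}.ncard : ℝ)
    rw [hAμ] at hy
    have hN : (τ + ε) * μ * p ^ r < ε * N := by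
      refine lt_of_mul_lt_mul_right ?_ (show (0 : ℝ) ≤ p ^ n by positivity)
      linarith
    -- The terms linear in `ε h` cancel. The quadratic loss `μ h² / q` uses at most half of the gain
    -- `μ h τ`; the other half is at least `p τ² / 8 > 8 n`.
    have hkey : Q * ξ + (n - 1) < h * ((τ + ε) * μ) := by
      have e1 : Q * ξ = μ * (ε * h) + μ * (n * (Q * x * x)) := by rw [hξ, ← hxQ]; ring
      have e2 : n * (Q * x * x) = h * (h / q) := by
        rw [hxQ, hx, hQq]
        field_simp
        rw [hε2]; ring
      have e3 : (h : ℝ) / q ≤ τ / 2 := by rw [div_le_iff₀ hq0]; linarith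
      have e4 : μ * (h * (h / q)) ≤ μ * (h * (τ / 2)) := by gcongr
      have e5 : p * τ ^ 2 / 8 ≤ μ * (h * (τ / 2)) := by
        calc p * τ ^ 2 / 8 ≤ (μ * q) * τ ^ 2 / 8 := by gcongr
          _ = μ * (τ * q / 4 * (τ / 2)) := by ring
          _ ≤ μ * (h * (τ / 2)) := by gcongr
      rw [e1, e2]
      linarith
    push_cast
    calc (d : ℝ) * p ^ r ≤ p * Q * (1 + ξ) * p ^ r := by gcongr
      _ = p * ((Q + Q * ξ) * p ^ r) := by ring
      _ ≤ p * (C₀ * p ^ r + h * ((τ + ε) * μ * p ^ r)) := by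
        have : (Q + Q * ξ) * p ^ r ≤ (C₀ + h * ((τ + ε) * μ)) * p ^ r :=
          mul_le_mul_of_nonneg_right (by linarith) (by positivity)
        exact mul_le_mul_of_nonneg_left (by linarith) hp0.le
      _ < p * (C₀ * p ^ r + h * (ε * N)) := by
        have hh : (0 : ℝ) < h := lt_of_lt_of_le (by positivity) hh1
        gcongr
      _ = p * (C₀ * p ^ r + (C₀ + ε * h - C₀) * N) := by ring
  have hle := Set.ncard_le_ncard hsub (Set.toFinite _)
  have hG : (0 : ℝ) < (grassmannian n r p).ncard := by exact_mod_cast ncard_grassmannian_pos hr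
  have hd2 : 2 * (d : ℝ) < δ * p ^ r := by
    calc 2 * (d : ℝ) ≤ 2 * (p * Q * (1 + ξ)) := by linarith
      _ ≤ 2 * (p * Q * 2) := by
        have := mul_le_mul_of_nonneg_left (by linarith : 1 + ξ ≤ 2) (mul_pos hp0 hQ0).le
        linarith
      _ = (4 * n) * (p * q) := by rw [hQq]; ring
      _ < (p * δ) * (p * q) :=
        mul_lt_mul_of_pos_right (by linarith) (mul_pos hp0 hq0)
      _ = δ * p ^ r := by rw [hpr]; ring
  refine lt_of_mul_lt_mul_right ?_ (show (0 : ℝ) ≤ p ^ r by positivity)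
  calc _ ≤ (2 * (d : ℝ)) * (grassmannian n r p).ncard := by
        exact_mod_cast (Nat.mul_le_mul_right _ hle).trans hmain
    _ < (δ * p ^ r) * (grassmannian n r p).ncard := mul_lt_mul_of_pos_right hd2 hG
    _ = _ := by ring

end SmoothCover

/-! ### Lattice point counts in convex bodies by averaging. -/

namespace SmoothCover

open MeasureTheory

variable {n : ℕ}

section Averaging

variable (Λ : Submodule ℤ (EuclideanSpace ℝ (Fin n))) [DiscreteTopology Λ] [IsZLattice ℝ Λ]

/-- The average of `coverCount Λ B` over a fundamental domain is `vol B / covol Λ`. -/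
theorem setLIntegral_coverCount {F : Set (EuclideanSpace ℝ (Fin n))}
    (hF : IsAddFundamentalDomain Λ F) {B : Set (EuclideanSpace ℝ (Fin n))}
    (hB : Bornology.IsBounded B) (hBm : MeasurableSet B) :
    ∫⁻ x in F, (coverCount Λ B x : ENNReal) = volume B := by
  -- Writing the count as a sum of indicators of translates of `-B` lets the integral over the
  -- fundamental domain unfold to the whole space.
  have hcount : ∀ x, (coverCount Λ B x : ENNReal) =
      ∑' l : Λ, (-B).indicator (fun _ => (1 : ENNReal)) (-l +ᵥ x) := by
    intro x
    have hfin : {l : Λ | (l : EuclideanSpace ℝ (Fin n)) ∈ x +ᵥ B}.Finite :=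
      ((finite_inter_vadd Λ hB x).preimage Subtype.val_injective.injOn).subset
        fun l hl => ⟨l.2, hl⟩
    have hmem : ∀ l : Λ, -l +ᵥ x ∈ -B ↔ (l : EuclideanSpace ℝ (Fin n)) ∈ x +ᵥ B := by
      intro l
      rw [Set.mem_neg, Set.mem_vadd_set_iff_neg_vadd_mem]
      simp [Submodule.vadd_def, vadd_eq_add, add_comm]
    rw [tsum_eq_sum (s := hfin.toFinset)]
    · rw [Finset.sum_congr rfl (g := fun _ => (1 : ENNReal))]
      · rw [Finset.sum_const, nsmul_one, coverCount, ← Set.ncard_eq_toFinset_card _ hfin]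
        congr 1
        rw [← Set.ncard_image_of_injective _ Subtype.val_injective]
        congr 1
        ext y
        simp [and_comm]
      · intro l hl
        exact Set.indicator_of_mem ((hmem l).2 (by simpa using hl)) _
    · intro l hl
      exact Set.indicator_of_notMem (fun h => hl (by simpa using (hmem l).1 h)) _
  simp only [hcount]
  have hm : Measurable ((-B).indicator fun _ => (1 : ENNReal)) :=
    measurable_const.indicator hBm.neg
  have : Countable Λ := inferInstance
  have : VAddInvariantMeasure Λ (EuclideanSpace ℝ (Fin n)) volume :=
    inferInstanceAs (VAddInvariantMeasure Λ.toAddSubgroup (EuclideanSpace ℝ (Fin n)) volume)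
  rw [lintegral_tsum (f := fun (l : Λ) x => (-B).indicator (fun _ => (1 : ENNReal)) (-l +ᵥ x))
    fun l => (hm.comp (measurable_const_vadd (-l))).aemeasurable,
    ← hF.lintegral_eq_tsum', lintegral_indicator_const hBm.neg, one_mul, Measure.measure_neg]

/-- A lower bound for all counts bounds their average. Passing to the closure supplies
measurability, at no cost because a convex set has null frontier; the reverse bound below uses the
interior instead. -/
theorem mul_covolume_le_of_le_coverCount {B : Set (EuclideanSpace ℝ (Fin n))} (hBc : Convex ℝ B)
    (hB : Bornology.IsBounded B) {N : ℕ} (h : ∀ x, N ≤ coverCount Λ B x) :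
    N * ZLattice.covolume Λ ≤ volume.real B := by
  let b := Module.Free.chooseBasis ℤ Λ
  have hF := ZLattice.isAddFundamentalDomain b (volume : Measure (EuclideanSpace ℝ (Fin n)))
  set F := ZSpan.fundamentalDomain (b.ofZLatticeBasis ℝ Λ)
  have hcl : volume (closure B) = volume B :=
    measure_closure_of_null_frontier (hBc.addHaar_frontier volume)
  have hle : ∫⁻ _ in F, (N : ENNReal) ≤ ∫⁻ x in F, (coverCount Λ (closure B) x : ENNReal) := by
    refine lintegral_mono fun x => ?_
    have : coverCount Λ B x ≤ coverCount Λ (closure B) x :=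
      Set.ncard_le_ncard (Set.inter_subset_inter_right _ (Set.vadd_set_mono subset_closure))
        (finite_inter_vadd Λ hB.closure x)
    exact Nat.cast_le.2 ((h x).trans this)
  rw [setLIntegral_coverCount Λ hF hB.closure isClosed_closure.measurableSet, hcl,
    setLIntegral_const] at hle
  rw [ZLattice.covolume_eq_measure_fundamentalDomain Λ volume hF]
  have := ENNReal.toReal_mono hB.measure_lt_top.ne hle
  simpa [Measure.real] using this

theorem le_mul_covolume_of_coverCount_le {B : Set (EuclideanSpace ℝ (Fin n))} (hBc : Convex ℝ B)
    (hB : Bornology.IsBounded B) {N : ℕ} (h : ∀ x, coverCount Λ B x ≤ N) :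
    volume.real B ≤ N * ZLattice.covolume Λ := by
  let b := Module.Free.chooseBasis ℤ Λ
  have hF := ZLattice.isAddFundamentalDomain b (volume : Measure (EuclideanSpace ℝ (Fin n)))
  set F := ZSpan.fundamentalDomain (b.ofZLatticeBasis ℝ Λ) with hFdef
  have hint : volume (interior B) = volume B :=
    measure_interior_of_null_frontier (hBc.addHaar_frontier volume)
  have hBi : Bornology.IsBounded (interior B) := hB.subset interior_subset
  have hle : ∫⁻ x in F, (coverCount Λ (interior B) x : ENNReal) ≤ ∫⁻ _ in F, (N : ENNReal) := by
    refine lintegral_mono fun x => ?_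
    have : coverCount Λ (interior B) x ≤ coverCount Λ B x :=
      Set.ncard_le_ncard (Set.inter_subset_inter_right _ (Set.vadd_set_mono interior_subset))
        (finite_inter_vadd Λ hB x)
    exact Nat.cast_le.2 (this.trans (h x))
  rw [setLIntegral_coverCount Λ hF hBi isOpen_interior.measurableSet, hint,
    setLIntegral_const] at hle
  rw [ZLattice.covolume_eq_measure_fundamentalDomain Λ volume hF]
  have hFt : volume F ≠ ⊤ := (ZSpan.fundamentalDomain_isBounded _).measure_lt_top.ne
  have := ENNReal.toReal_mono (ENNReal.mul_ne_top (by simp) hFt) hle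
  simpa [Measure.real] using this

end Averaging

/-- If `u • K` covers, then any translate of `t • K` lies in a lattice translate of any given
translate of `(t + u) • K`. -/
theorem coverCount_smul_le (Λ : Submodule ℤ (EuclideanSpace ℝ (Fin n))) [DiscreteTopology Λ]
    {K : Set (EuclideanSpace ℝ (Fin n))} (hK : Convex ℝ K)
    (hKb : Bornology.IsBounded K) {t u : ℝ} (ht : 0 ≤ t) (hu : 0 ≤ u)
    (hcov : IsCovering Λ (u • K)) (x x' : EuclideanSpace ℝ (Fin n)) :
    coverCount Λ (t • K) x ≤ coverCount Λ ((t + u) • K) x' := by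
  obtain ⟨l, hl, k, hk, hlk⟩ : x - x' ∈ (Λ : Set (EuclideanSpace ℝ (Fin n))) + u • K := by
    rw [hcov]
    trivial
  refine Set.ncard_le_ncard_of_injOn (fun y => y - l) ?_ (sub_left_injective.injOn)
    (finite_inter_vadd Λ (hKb.smul₀ _) x')
  rintro _ ⟨hy, k', hk', rfl⟩
  refine ⟨Λ.sub_mem hy hl, k' + k, ?_, ?_⟩
  · rw [hK.add_smul ht hu]
    exact Set.add_mem_add hk' hk
  · have : x = l + k + x' := by
      change l + k = x - x' at hlk
      rw [hlk]; abel
    simp only [vadd_eq_add, this]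
    abel

/-- `K` may miss the origin, so `s • K` need not lie in `t • K`; by convexity, though, a translate
of it does. -/
theorem IsPacking.smul_mono {L : Submodule ℤ (EuclideanSpace ℝ (Fin n))}
    {K : Set (EuclideanSpace ℝ (Fin n))} (hK : Convex ℝ K) {s t : ℝ} (hs : 0 ≤ s) (hst : s ≤ t)
    (h : IsPacking L (t • K)) : IsPacking L (s • K) := by
  intro l hl l' hl' hne
  rw [Function.onFun, Set.disjoint_left]
  rintro _ ⟨k, hk, rfl⟩ ⟨k', hk', hkk⟩
  obtain ⟨k₀, hk₀, -⟩ := id hk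
  have hmem : ∀ k ∈ s • K, k + (t - s) • k₀ ∈ t • K := by
    intro k hk
    have : t • K = s • K + (t - s) • K := by
      rw [← hK.add_smul hs (sub_nonneg.2 hst), add_sub_cancel]
    rw [this]
    exact Set.add_mem_add hk (Set.smul_mem_smul_set hk₀)
  refine Set.disjoint_left.1 (h hl hl' hne) ⟨_, hmem k hk, rfl⟩ ⟨_, hmem k' hk', ?_⟩
  simp only [vadd_eq_add] at hkk ⊢
  rw [← add_assoc, hkk, add_assoc]

end SmoothCover

/-! ### Superlattices and residues mod `p`. -/

namespace SmoothCover

open MeasureTheory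

variable {n : ℕ} {L : Submodule ℤ (EuclideanSpace ℝ (Fin n))}

/-- The point `(1/p) g z` of the lattice `(1/p) L`. -/
noncomputable def scaledPoint (b : Module.Basis (Fin n) ℤ L) (p : ℕ) :
    (Fin n → ℤ) →+ EuclideanSpace ℝ (Fin n) where
  toFun z := (p : ℝ)⁻¹ • ∑ i, z i • (b i : EuclideanSpace ℝ (Fin n))
  map_zero' := by simp
  map_add' z w := by simp [add_smul, Finset.sum_add_distrib]

/-- Coordinatewise reduction mod `p`. -/
def reduction (n p : ℕ) : (Fin n → ℤ) →+ (Fin n → ZMod p) where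
  toFun z i := z i
  map_zero' := by ext; simp
  map_add' z w := by ext; simp

theorem reduction_surjective (p : ℕ) : Function.Surjective (reduction n p) := by
  intro a
  choose z hz using fun i => ZMod.intCast_surjective (a i)
  exact ⟨z, funext hz⟩

theorem mem_superlattice {b : Module.Basis (Fin n) ℤ L} {p : ℕ}
    {S : Submodule (ZMod p) (Fin n → ZMod p)} {x : EuclideanSpace ℝ (Fin n)} :
    x ∈ superlattice b p S ↔ ∃ z, reduction n p z ∈ S ∧ scaledPoint b p z = x :=
  ⟨fun ⟨z, hz, h⟩ => ⟨z, hz, h.symm⟩, fun ⟨z, hz, h⟩ => ⟨z, hz, h.symm⟩⟩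

theorem sum_repr_coe (b : Module.Basis (Fin n) ℤ L) (x : L) :
    ∑ i, b.repr x i • (b i : EuclideanSpace ℝ (Fin n)) = x := by
  simpa only [Submodule.coe_sum, Submodule.coe_smul] using congrArg Subtype.val (b.sum_repr x)

variable {p : ℕ} [Fact p.Prime]

theorem cast_prime_ne_zero (p : ℕ) [Fact p.Prime] : (p : ℝ) ≠ 0 :=
  Nat.cast_ne_zero.2 (Fact.out : p.Prime).ne_zero

theorem scaledPoint_injective (b : Module.Basis (Fin n) ℤ L) :
    Function.Injective (scaledPoint b p) := by
  rw [injective_iff_map_eq_zero]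
  intro z hz
  have h : ∑ i, z i • (b i : EuclideanSpace ℝ (Fin n)) = 0 :=
    (smul_eq_zero_iff_right (inv_ne_zero (cast_prime_ne_zero p))).1 hz
  have h' : ∑ i, z i • b i = 0 := by
    apply Subtype.ext
    simpa using h
  exact funext (Fintype.linearIndependent_iff.1 b.linearIndependent z h')

theorem scaledPoint_natCast_smul (b : Module.Basis (Fin n) ℤ L) (z : Fin n → ℤ) :
    scaledPoint b p ((p : ℤ) • z) = ∑ i, z i • (b i : EuclideanSpace ℝ (Fin n)) := by
  change (p : ℝ)⁻¹ • ∑ i, ((p : ℤ) • z) i • (b i : EuclideanSpace ℝ (Fin n)) = _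
  rw [inv_smul_eq_iff₀ (cast_prime_ne_zero p), Finset.smul_sum]
  refine Finset.sum_congr rfl fun i _ => ?_
  rw [Pi.smul_apply, smul_assoc, ← Int.cast_smul_eq_zsmul ℝ (p : ℤ), Int.cast_natCast]

theorem reduction_eq_zero_iff {z : Fin n → ℤ} :
    reduction n p z = 0 ↔ ∃ m : Fin n → ℤ, z = (p : ℤ) • m := by
  constructor
  · intro h
    have hd : ∀ i, (p : ℤ) ∣ z i := fun i => (ZMod.intCast_zmod_eq_zero_iff_dvd _ _).1 (congrFun h i)
    choose m hm using hd
    exact ⟨m, funext hm⟩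
  · rintro ⟨m, rfl⟩
    ext i
    simp [reduction]

theorem scaledPoint_mem_iff (b : Module.Basis (Fin n) ℤ L) {z : Fin n → ℤ} :
    scaledPoint b p z ∈ L ↔ reduction n p z = 0 := by
  rw [reduction_eq_zero_iff]
  constructor
  · intro h
    refine ⟨b.repr ⟨_, h⟩, scaledPoint_injective (p := p) b ?_⟩
    rw [scaledPoint_natCast_smul]
    exact (sum_repr_coe b ⟨_, h⟩).symm
  · rintro ⟨m, rfl⟩
    rw [scaledPoint_natCast_smul]
    exact L.sum_mem fun i _ => L.smul_mem _ (b i).2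

theorem le_superlattice (b : Module.Basis (Fin n) ℤ L)
    (S : Submodule (ZMod p) (Fin n → ZMod p)) : L ≤ superlattice b p S := by
  intro x hx
  refine mem_superlattice.2 ⟨(p : ℤ) • ⇑(b.repr ⟨x, hx⟩), ?_, ?_⟩
  · rw [reduction_eq_zero_iff.2 ⟨_, rfl⟩]
    exact S.zero_mem
  · rw [scaledPoint_natCast_smul]
    exact sum_repr_coe b ⟨x, hx⟩

/-- The index of `L` in `L(S)` is the cardinality of `S`: both lattices are injective images of
preimages under reduction. -/
theorem covolume_superlattice [DiscreteTopology L] [IsZLattice ℝ L]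
    (b : Module.Basis (Fin n) ℤ L) (S : Submodule (ZMod p) (Fin n → ZMod p)) :
    ZLattice.covolume L =
      p ^ Module.finrank (ZMod p) S * ZLattice.covolume (superlattice b p S) := by
  have h := ZLattice.covolume_div_covolume_eq_relIndex' L (superlattice b p S)
    (le_superlattice b S)
  have hS : (superlattice b p S).toAddSubgroup =
      (S.toAddSubgroup.comap (reduction n p)).map (scaledPoint b p) := by
    ext x
    exact mem_superlattice
  have hL : L.toAddSubgroup =
      ((⊥ : AddSubgroup (Fin n → ZMod p)).comap (reduction n p)).map (scaledPoint b p) := by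
    ext x
    constructor
    · intro hx
      obtain ⟨z, -, rfl⟩ := mem_superlattice.1 (le_superlattice (p := p) b ⊥ hx)
      exact ⟨z, (scaledPoint_mem_iff b).1 hx, rfl⟩
    · rintro ⟨z, hz, rfl⟩
      exact (scaledPoint_mem_iff b).2 hz
  have hcard : L.toAddSubgroup.relIndex (superlattice b p S).toAddSubgroup =
      p ^ Module.finrank (ZMod p) S := by
    rw [hS, hL, AddSubgroup.relIndex_map_map_of_injective _ _ (scaledPoint_injective b),
      AddSubgroup.relIndex_comap, AddSubgroup.map_comap_eq_self_of_surjective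
        (reduction_surjective p), AddSubgroup.relIndex_bot_left]
    have := Module.natCard_eq_pow_finrank (K := ZMod p) (V := S)
    rw [Nat.card_zmod] at this
    exact this
  rw [hcard, div_eq_iff (ZLattice.covolume_ne_zero _ _)] at h
  rw [h, Nat.cast_pow]

theorem coverCount_superlattice (b : Module.Basis (Fin n) ℤ L)
    (S : Submodule (ZMod p) (Fin n → ZMod p)) (K : Set (EuclideanSpace ℝ (Fin n)))
    (x : EuclideanSpace ℝ (Fin n)) :
    coverCount (superlattice b p S) K x =
      {z | reduction n p z ∈ S ∧ scaledPoint b p z ∈ x +ᵥ K}.ncard := by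
  rw [coverCount, ← Set.ncard_image_of_injective _ (scaledPoint_injective (p := p) b)]
  congr 1
  ext y
  constructor
  · rintro ⟨hy, hyK⟩
    obtain ⟨z, hz, rfl⟩ := mem_superlattice.1 hy
    exact ⟨z, ⟨hz, hyK⟩, rfl⟩
  · rintro ⟨z, ⟨hz, hzK⟩, rfl⟩
    exact ⟨mem_superlattice.2 ⟨z, hz, rfl⟩, hzK⟩

theorem finite_scaledPoint_mem [DiscreteTopology L] (b : Module.Basis (Fin n) ℤ L)
    {K : Set (EuclideanSpace ℝ (Fin n))} (hK : Bornology.IsBounded K)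
    (x : EuclideanSpace ℝ (Fin n)) : {z | scaledPoint b p z ∈ x +ᵥ K}.Finite := by
  refine ((finite_inter_vadd (superlattice b p ⊤) hK x).preimage
    (scaledPoint_injective (p := p) b).injOn).subset fun z hz => ⟨?_, hz⟩
  exact mem_superlattice.2 ⟨z, trivial, rfl⟩

/-- The residues mod `p` of the points of `(1/p) L` in `K`. -/
def residues (b : Module.Basis (Fin n) ℤ L) (p : ℕ) (K : Set (EuclideanSpace ℝ (Fin n))) :
    Set (Fin n → ZMod p) :=
  reduction n p '' {z | scaledPoint b p z ∈ K}

/-- Two points of `(1/p) L` with equal residues differ by an element of `L`, and a nonzero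
difference would make two translates of `K` meet. -/
theorem injOn_reduction (b : Module.Basis (Fin n) ℤ L) {K : Set (EuclideanSpace ℝ (Fin n))}
    (h : IsPacking L K) : Set.InjOn (reduction n p) {z | scaledPoint b p z ∈ K} := by
  intro z hz z' hz' he
  by_contra hne
  have hmem : scaledPoint b p (z - z') ∈ L := by
    rw [scaledPoint_mem_iff, map_sub, he, sub_self]
  have h0 : scaledPoint b p (z - z') ≠ 0 := by
    rw [Ne, map_eq_zero_iff _ (scaledPoint_injective b)]
    exact sub_ne_zero.2 hne
  refine Set.disjoint_left.1 (h hmem L.zero_mem h0) ⟨_, hz', rfl⟩ (?_ : _ ∈ _)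
  refine ⟨_, hz, ?_⟩
  simp [map_sub]

theorem ncard_residues (b : Module.Basis (Fin n) ℤ L) {K : Set (EuclideanSpace ℝ (Fin n))}
    (h : IsPacking L K) : (residues b p K).ncard = coverCount (superlattice b p ⊤) K 0 := by
  rw [residues, (injOn_reduction b h).ncard_image, coverCount_superlattice]
  simp

theorem isCovering_superlattice_top (b : Module.Basis (Fin n) ℤ L)
    {K : Set (EuclideanSpace ℝ (Fin n))} {c : ℝ} (h : IsCovering L (c • K)) :
    IsCovering (superlattice b p ⊤) ((c / p) • K) := by
  have hp := cast_prime_ne_zero p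
  refine Set.eq_univ_of_forall fun x => ?_
  obtain ⟨l, hl, _, ⟨k, hk, rfl⟩, hlk⟩ : (p : ℝ) • x ∈
      (L : Set (EuclideanSpace ℝ (Fin n))) + c • K := by
    rw [h]
    trivial
  refine ⟨(p : ℝ)⁻¹ • l, mem_superlattice.2 ⟨b.repr ⟨l, hl⟩, trivial, ?_⟩, _,
    ⟨k, hk, rfl⟩, ?_⟩
  · exact congrArg ((p : ℝ)⁻¹ • ·) (sum_repr_coe b ⟨l, hl⟩)
  · change l + c • k = (p : ℝ) • x at hlk
    change (p : ℝ)⁻¹ • l + (c / p) • k = x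
    rw [← inv_smul_smul₀ hp x, ← hlk, smul_add, smul_smul, div_eq_inv_mul]

/-- Round `x` to a point of `(1/p) L` with remainder in `u • K`. Subtracting that point moves `x +
K` into `(1 + u) • K` and turns `S` into one of its cosets. -/
theorem coverCount_superlattice_le [DiscreteTopology L] (b : Module.Basis (Fin n) ℤ L)
    {K : Set (EuclideanSpace ℝ (Fin n))} (hK : Convex ℝ K) {u : ℝ} (hu : 0 ≤ u)
    (hcov : IsCovering (superlattice b p ⊤) (u • K)) (hpack : IsPacking L ((1 + u) • K))
    (S : Submodule (ZMod p) (Fin n → ZMod p)) (x : EuclideanSpace ℝ (Fin n)) :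
    ∃ y, coverCount (superlattice b p S) K x ≤
      {a ∈ residues b p ((1 + u) • K) | a + y ∈ S}.ncard := by
  obtain ⟨l, hl, k, hk, hlk⟩ : x ∈
      (superlattice b p ⊤ : Set (EuclideanSpace ℝ (Fin n))) + u • K := by
    rw [hcov]
    trivial
  obtain ⟨z₀, -, rfl⟩ := mem_superlattice.1 hl
  change scaledPoint b p z₀ + k = x at hlk
  have hmem : ∀ z, scaledPoint b p z ∈ x +ᵥ K → scaledPoint b p (z - z₀) ∈ (1 + u) • K := by
    rintro z ⟨k', hk', hz⟩
    rw [hK.add_smul zero_le_one hu, one_smul]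
    refine ⟨k', hk', k, hk, ?_⟩
    change x + k' = _ at hz
    change k' + k = _
    rw [map_sub, ← hz, ← hlk]
    abel
  refine ⟨reduction n p z₀, ?_⟩
  rw [coverCount_superlattice]
  refine Set.ncard_le_ncard_of_injOn (fun z => reduction n p (z - z₀)) ?_ ?_ (Set.toFinite _)
  · rintro z ⟨hzS, hz⟩
    refine ⟨⟨_, hmem z hz, rfl⟩, ?_⟩
    simpa using hzS
  · rintro z ⟨-, hz⟩ z' ⟨-, hz'⟩ he
    exact sub_left_injective (injOn_reduction b hpack (hmem z hz) (hmem z' hz') he)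

theorem le_coverCount_superlattice [DiscreteTopology L] (b : Module.Basis (Fin n) ℤ L)
    {K : Set (EuclideanSpace ℝ (Fin n))} (hK : Convex ℝ K) (hKb : Bornology.IsBounded K) {u : ℝ}
    (hu : 0 ≤ u) (hu1 : u ≤ 1) (hcov : IsCovering (superlattice b p ⊤) (u • K))
    (S : Submodule (ZMod p) (Fin n → ZMod p)) (x : EuclideanSpace ℝ (Fin n)) :
    ∃ y, {a ∈ residues b p ((1 - u) • K) | a + y ∈ S}.ncard ≤
      coverCount (superlattice b p S) K x := by
  -- Here `-x` is rounded, not `x`: `K` need not be symmetric, and the remainder must be added to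
  -- points of `(1 - u) • K` to land in `K`.
  obtain ⟨l, hl, k, hk, hlk⟩ : -x ∈
      (superlattice b p ⊤ : Set (EuclideanSpace ℝ (Fin n))) + u • K := by
    rw [hcov]
    trivial
  obtain ⟨z₀, -, rfl⟩ := mem_superlattice.1 hl
  change scaledPoint b p z₀ + k = -x at hlk
  refine ⟨-reduction n p z₀, ?_⟩
  rw [coverCount_superlattice]
  have hfin : {z | reduction n p z ∈ S ∧ scaledPoint b p z ∈ x +ᵥ K}.Finite :=
    (finite_scaledPoint_mem b hKb x).subset fun z hz => hz.2
  refine le_trans (Set.ncard_le_ncard (t := (fun z => reduction n p (z + z₀)) '' _) ?_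
    (hfin.image _)) (Set.ncard_image_le hfin)
  rintro _ ⟨⟨z, hz, rfl⟩, hzS⟩
  refine ⟨z - z₀, ⟨by simpa [sub_eq_add_neg] using hzS, ?_⟩, by simp⟩
  have hz' : scaledPoint b p z + k ∈ K := by
    have h : scaledPoint b p z + k ∈ (1 - u) • K + u • K := Set.add_mem_add hz hk
    rwa [← hK.add_smul (sub_nonneg.2 hu1) hu, sub_add_cancel, one_smul] at h
  refine ⟨_, hz', ?_⟩
  have : x = -(scaledPoint b p z₀ + k) := by rw [hlk, neg_neg]
  simp only [vadd_eq_add, map_sub, this]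
  abel

end SmoothCover

/-! ### From balanced residues to covering smoothness. -/

namespace SmoothCover

open MeasureTheory

variable {n p : ℕ} [Fact p.Prime] {L : Submodule ℤ (EuclideanSpace ℝ (Fin n))}
  [DiscreteTopology L] [IsZLattice ℝ L]

theorem volume_real_smul (K : Set (EuclideanSpace ℝ (Fin n))) {s : ℝ} (hs : 0 ≤ s) :
    volume.real (s • K) = s ^ n * volume.real K := by
  rw [Measure.real, Measure.addHaar_smul, ENNReal.toReal_mul, ENNReal.toReal_ofReal (abs_nonneg _),
    finrank_euclideanSpace_fin, abs_of_nonneg (by positivity), Measure.real]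

theorem IsConvBody.volume_real_pos {K : Set (EuclideanSpace ℝ (Fin n))} (hK : IsConvBody K) :
    0 < volume.real K :=
  ENNReal.toReal_pos
    ((isOpen_interior.measure_pos volume hK.2.2).trans_le (measure_mono interior_subset)).ne'
    hK.2.1.measure_lt_top.ne

/-- The count in `s • K` is at most the count in every translate of `(s + u) • K`, hence at most the
average of the latter. The companion lower bound compares with `(s - u) • K`. -/
theorem ncard_residues_le (b : Module.Basis (Fin n) ℤ L) {K : Set (EuclideanSpace ℝ (Fin n))}
    (hK : IsConvBody K) {u s : ℝ} (hu : 0 ≤ u) (hs : 0 ≤ s)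
    (hcov : IsCovering (superlattice b p ⊤) (u • K)) (hpack : IsPacking L (s • K)) :
    ((residues b p (s • K)).ncard : ℝ) ≤
      (s + u) ^ n * (volume.real K / ZLattice.covolume L * p ^ n) := by
  have h := mul_covolume_le_of_le_coverCount (superlattice b p ⊤) (hK.1.smul (s + u))
    (hK.2.1.smul₀ (s + u)) fun x => coverCount_smul_le _ hK.1 hK.2.1 hs hu hcov 0 x
  rw [ncard_residues b hpack]
  have hcovol := covolume_superlattice (p := p) b ⊤
  rw [finrank_top, Module.finrank_fin_fun] at hcovol
  have hΛ := ZLattice.covolume_pos (superlattice b p ⊤) volume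
  have hp := cast_prime_ne_zero p
  rw [volume_real_smul _ (add_nonneg hs hu)] at h
  rw [hcovol]
  refine le_of_mul_le_mul_right (h.trans_eq ?_) hΛ
  field_simp

theorem le_ncard_residues (b : Module.Basis (Fin n) ℤ L) {K : Set (EuclideanSpace ℝ (Fin n))}
    (hK : IsConvBody K) {u s : ℝ} (hu : 0 ≤ u) (hus : u ≤ s)
    (hcov : IsCovering (superlattice b p ⊤) (u • K)) (hpack : IsPacking L (s • K)) :
    (s - u) ^ n * (volume.real K / ZLattice.covolume L * p ^ n) ≤
      ((residues b p (s • K)).ncard : ℝ) := by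
  have h := le_mul_covolume_of_coverCount_le (superlattice b p ⊤) (hK.1.smul (s - u))
    (hK.2.1.smul₀ (s - u)) (N := coverCount (superlattice b p ⊤) (s • K) 0) fun x => by
      simpa using coverCount_smul_le _ hK.1 hK.2.1 (sub_nonneg.2 hus) hu hcov x 0
  rw [ncard_residues b hpack]
  have hcovol := covolume_superlattice (p := p) b ⊤
  rw [finrank_top, Module.finrank_fin_fun] at hcovol
  have hΛ := ZLattice.covolume_pos (superlattice b p ⊤) volume
  have hp := cast_prime_ne_zero p
  rw [volume_real_smul _ (sub_nonneg.2 hus)] at h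
  rw [hcovol]
  refine le_of_mul_le_mul_right (le_of_eq_of_le ?_ h) hΛ
  field_simp

/-- Exponentiating the condition on `r` gives `p³ e^{3nu} ≤ V p^r`, and `(1 - 2u) e^{3u} ≥ (1 -
2u)(1 + 3u) ≥ 1` for `0 ≤ u ≤ 1/6`. -/
theorem pow_three_le {V p c u : ℝ} {n r : ℕ} (hV : 0 < V) (hp : 1 < p) (hu : u = c / p)
    (hu0 : 0 ≤ u) (hu1 : u ≤ 1 / 6)
    (hr : (r : ℝ) > 3 + Real.logb p V⁻¹ + 3 * c * (n / (p * Real.log p))) :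
    p ^ 3 ≤ (1 - 2 * u) ^ n * (V * p ^ r) := by
  have hlog := Real.log_pos hp
  have hp0 : 0 < p := by linarith
  have h1 : 3 * Real.log p + 3 * n * u ≤ Real.log V + r * Real.log p := by
    have h := mul_lt_mul_of_pos_right hr hlog
    rw [Real.logb, Real.log_inv] at h
    have e : (3 + -Real.log V / Real.log p + 3 * c * (n / (p * Real.log p))) * Real.log p =
        3 * Real.log p - Real.log V + 3 * n * u := by
      rw [hu]
      field_simp
      ring
    linarith
  have h2 : p ^ 3 * Real.exp (3 * n * u) ≤ V * p ^ r := by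
    have := Real.exp_le_exp.2 h1
    rw [Real.exp_add, Real.exp_add, Real.exp_log hV, mul_comm (r : ℝ), ← Real.rpow_def_of_pos hp0,
      mul_comm (3 : ℝ) (Real.log p), ← Real.rpow_def_of_pos hp0, Real.rpow_natCast] at this
    have h3 : p ^ (3 : ℝ) = p ^ 3 := by exact_mod_cast Real.rpow_natCast p 3
    rwa [h3] at this
  have h4 : 1 ≤ (1 - 2 * u) ^ n * Real.exp (3 * n * u) := by
    have e : Real.exp (3 * n * u) = Real.exp (3 * u) ^ n := by
      rw [← Real.exp_nat_mul]
      ring_nf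
    rw [e, ← mul_pow]
    refine one_le_pow₀ ?_
    have := Real.add_one_le_exp (3 * u)
    nlinarith
  have h5 : 0 ≤ (1 - 2 * u) ^ n := pow_nonneg (by linarith) n
  calc p ^ 3 ≤ p ^ 3 * ((1 - 2 * u) ^ n * Real.exp (3 * n * u)) :=
        le_mul_of_one_le_right (by positivity) h4
    _ = (1 - 2 * u) ^ n * (p ^ 3 * Real.exp (3 * n * u)) := by ring
    _ ≤ _ := mul_le_mul_of_nonneg_left h2 h5

/-- A direction in which the residues of `(1 ± u) • K` are balanced gives a smooth superlattice. -/
theorem smoothness_superlattice_le (b : Module.Basis (Fin n) ℤ L)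
    {K : Set (EuclideanSpace ℝ (Fin n))} (hK : IsConvBody K) {u τ : ℝ} {r : ℕ} (hu0 : 0 ≤ u)
    (hu1 : n * u ≤ 1 / 2) (hu2 : u ≤ 1 / 6) (hτ0 : 0 < τ) (hτ1 : τ < 1)
    (hcov : IsCovering (superlattice b p ⊤) (u • K)) (hpack : IsPacking L ((1 + u) • K))
    {S : Submodule (ZMod p) (Fin n → ZMod p)} (hS : S ∈ grassmannian n r p)
    (hupper : ∀ y, ({a ∈ residues b p ((1 + u) • K) | a + y ∈ S}.ncard : ℝ) * p ^ n ≤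
      (1 + τ) * ((residues b p ((1 + u) • K)).ncard * p ^ r))
    (hlower : ∀ y, (1 - τ) * ((residues b p ((1 - u) • K)).ncard * p ^ r) ≤
      ({a ∈ residues b p ((1 - u) • K) | a + y ∈ S}.ncard : ℝ) * p ^ n) :
    smoothness K (superlattice b p S) ≤ τ + 4 * (n * u) * (1 + τ) := by
  have hp : (0 : ℝ) < p := lt_of_le_of_ne (Nat.cast_nonneg p) (cast_prime_ne_zero p).symm
  have hpn : (0 : ℝ) < p ^ n := by positivity
  have hK0 := hK.volume_real_pos
  have hL0 := ZLattice.covolume_pos L volume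
  set V := volume.real K / ZLattice.covolume L with hV
  have hV0 : 0 < V := by positivity
  have hVS : volume.real K / ZLattice.covolume (superlattice b p S) = V * p ^ r := by
    have h := covolume_superlattice b S
    have hS' : Module.finrank (ZMod p) S = r := hS
    rw [hS'] at h
    have := ZLattice.covolume_pos (superlattice b p S) volume
    rw [hV, h]
    field_simp
  have hM : 0 < V * (p : ℝ) ^ r := by positivity
  have hplus := ncard_residues_le b hK hu0 (by linarith : 0 ≤ 1 + u) hcov hpack
  have hminus := le_ncard_residues b hK hu0 (by linarith : u ≤ 1 - u) hcov
    (hpack.smul_mono hK.1 (by linarith) (by linarith : 1 - u ≤ 1 + u))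
  -- Since `2 n u ≤ 1`, the quadratic term `(2 n u)²` is absorbed into a second `2 n u`.
  have hpow : (1 + u + u) ^ n ≤ 1 + 4 * (n * u) := by
    have h : |n * (u + u)| ≤ 1 := by
      rw [abs_of_nonneg (by positivity)]
      linarith
    have hnu : 0 ≤ n * u := by positivity
    have := one_add_pow_le h (by linarith)
    rw [add_assoc]
    nlinarith
  have hpow' : 1 - 2 * (n * u) ≤ (1 - u - u) ^ n := by
    have := one_add_mul_le_pow (by linarith : -2 ≤ -(u + u)) n
    calc 1 - 2 * (n * u) = 1 + n * -(u + u) := by ring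
      _ ≤ (1 + -(u + u)) ^ n := this
      _ = _ := by ring
  have hnu : 0 ≤ n * u := by positivity
  refine ciSup_le fun x => ?_
  rw [hVS, abs_le]
  constructor
  · obtain ⟨y, hy⟩ := le_coverCount_superlattice b hK.1 hK.2.1 hu0 (by linarith) hcov S x
    have h1 : (1 - τ) * (1 - 2 * (n * u)) * (V * p ^ r) ≤ coverCount (superlattice b p S) K x := by
      refine le_of_mul_le_mul_right ?_ hpn
      calc (1 - τ) * (1 - 2 * (n * u)) * (V * p ^ r) * p ^ n
          = (1 - τ) * ((1 - 2 * (n * u)) * (V * p ^ n) * p ^ r) := by ring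
        _ ≤ (1 - τ) * ((residues b p ((1 - u) • K)).ncard * p ^ r) := by
          have h := (mul_le_mul_of_nonneg_right hpow' (by positivity : 0 ≤ V * (p : ℝ) ^ n)).trans
            hminus
          exact mul_le_mul_of_nonneg_left (mul_le_mul_of_nonneg_right h (by positivity))
            (by linarith)
        _ ≤ _ := hlower y
        _ ≤ _ := mul_le_mul_of_nonneg_right (Nat.cast_le.2 hy) hpn.le
    have h2 := (le_div_iff₀ hM).2 h1
    nlinarith
  · obtain ⟨y, hy⟩ := coverCount_superlattice_le b hK.1 hu0 hcov hpack S x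
    have h1 : (coverCount (superlattice b p S) K x : ℝ) ≤
        (1 + τ) * (1 + 4 * (n * u)) * (V * p ^ r) := by
      refine le_of_mul_le_mul_right ?_ hpn
      calc (coverCount (superlattice b p S) K x : ℝ) * p ^ n ≤ _ :=
            mul_le_mul_of_nonneg_right (Nat.cast_le.2 hy) hpn.le
        _ ≤ _ := hupper y
        _ ≤ (1 + τ) * ((1 + 4 * (n * u)) * (V * p ^ n) * p ^ r) := by
          have h := hplus.trans
            (mul_le_mul_of_nonneg_right hpow (by positivity : 0 ≤ V * (p : ℝ) ^ n))
          exact mul_le_mul_of_nonneg_left (mul_le_mul_of_nonneg_right h (by positivity))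
            (by linarith)
        _ = _ := by ring
    have h2 := (div_le_iff₀ hM).2 h1
    linarith

end SmoothCover

theorem theorem3p4 (n : ℕ) (hn : 5 ≤ n) (δ τ : ℝ) (hδ : δ ∈ Set.Ioo (0 : ℝ) 1)
    (hτ : τ ∈ Set.Ioo (0 : ℝ) 1) (p : ℕ) [Fact p.Prime]
    (hp : (p : ℝ) > 64 * (n : ℝ) / (τ * δ) ^ 2)
    (L : Submodule ℤ (EuclideanSpace ℝ (Fin n))) [DiscreteTopology L] [IsZLattice ℝ L]
    (b : Module.Basis (Fin n) ℤ L)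
    (K : Set (EuclideanSpace ℝ (Fin n))) (hK : SmoothCover.IsConvBody K)
    (c : ℝ) (hc1 : 1 < c) (hc2 : c < (p : ℝ) / (2 * (n : ℝ)))
    (hpack : SmoothCover.IsPacking L ((1 + c / (p : ℝ)) • K))
    (hcov : SmoothCover.IsCovering L (c • K))
    (r : ℕ) (hr4 : 4 ≤ r) (hrn : r ≤ n)
    (hr : (r : ℝ) > 3 + Real.logb (p : ℝ) (ZLattice.covolume L / MeasureTheory.volume.real K)
      + 3 * c * ((n : ℝ) / ((p : ℝ) * Real.log (p : ℝ)))) :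
    SmoothCover.grassmannianProb n r p
      (fun S => SmoothCover.smoothness K (SmoothCover.superlattice b p S)
        ≥ τ + 8 * c * ((n : ℝ) / (p : ℝ))) < 2 * δ := by
  open SmoothCover MeasureTheory in
  have hn' : (5 : ℝ) ≤ n := by exact_mod_cast hn
  have hp1 : (1 : ℝ) < p := by exact_mod_cast (Fact.out : p.Prime).one_lt
  have hp0 : (0 : ℝ) < p := by linarith
  set u := c / (p : ℝ) with hu
  have hu0 : 0 < u := div_pos (by linarith) hp0
  have hnu : n * u < 1 / 2 := by
    rw [lt_div_iff₀ (by positivity)] at hc2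
    rw [hu, ← mul_div_assoc, div_lt_iff₀ hp0]
    linarith
  have hu6 : u ≤ 1 / 6 := by nlinarith
  have hcov' := isCovering_superlattice_top (p := p) b hcov
  have hV0 : 0 < volume.real K / ZLattice.covolume L :=
    div_pos hK.volume_real_pos (ZLattice.covolume_pos L volume)
  have hcube : (p : ℝ) ^ 3 ≤ (1 - 2 * u) ^ n * (volume.real K / ZLattice.covolume L * p ^ r) :=
    pow_three_le hV0 hp1 hu hu0.le hu6 (by rwa [inv_div])
  -- Both residue sets are large enough for equidistribution; `s = 1 - u` is the worst case and
  -- produces the factor `(1 - 2u)ⁿ`.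
  have hlarge : ∀ s, 1 - u ≤ s → s ≤ 1 + u →
      (p : ℝ) ^ n * p ^ 3 ≤ (residues b p (s • K)).ncard * p ^ r := by
    intro s hs1 hs2
    have h := le_ncard_residues b hK hu0.le (by linarith : u ≤ s) hcov'
      (hpack.smul_mono hK.1 (by linarith) hs2)
    calc (p : ℝ) ^ n * p ^ 3
        ≤ p ^ n * ((1 - 2 * u) ^ n * (volume.real K / ZLattice.covolume L * p ^ r)) := by gcongr
      _ = (1 - 2 * u) ^ n * (volume.real K / ZLattice.covolume L * p ^ n) * p ^ r := by ring
      _ ≤ (s - u) ^ n * (volume.real K / ZLattice.covolume L * p ^ n) * p ^ r := by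
        gcongr ?_ ^ n * _ * _
        · linarith
        · linarith
      _ ≤ _ := by gcongr
  have hplus := ncard_unbalanced_lt (ε := 1) (by omega) (by omega) hrn hδ hτ hp (Or.inl rfl)
    (residues b p ((1 + u) • K)) (hlarge _ (by linarith) le_rfl)
  have hminus := ncard_unbalanced_lt (ε := -1) (by omega) (by omega) hrn hδ hτ hp (Or.inr rfl)
    (residues b p ((1 - u) • K)) (hlarge _ le_rfl (by linarith))
  have hG : (0 : ℝ) < (grassmannian n r p).ncard := by exact_mod_cast ncard_grassmannian_pos hrn
  rw [grassmannianProb, div_lt_iff₀ hG]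
  refine lt_of_le_of_lt ?_ ((add_lt_add hplus hminus).trans_eq (by ring))
  rw [← Nat.cast_add, Nat.cast_le]
  refine le_trans (Set.ncard_le_ncard ?_ (Set.toFinite _)) (Set.ncard_union_le _ _)
  rintro S ⟨hS, hbad⟩
  by_contra hgood
  simp only [Set.mem_union, Set.mem_ofPred_eq, not_or, not_and, not_exists, not_lt] at hgood
  have hle := smoothness_superlattice_le b hK hu0.le hnu.le hu6 hτ.1 hτ.2 hcov' hpack hS
    (fun y => by linarith [hgood.1 hS y]) (fun y => by linarith [hgood.2 hS y])
  have hcu : 8 * c * ((n : ℝ) / p) = 8 * (n * u) := by rw [hu]; ring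
  have hnu0 : 0 < n * u := by positivity
  rw [ge_iff_le, hcu] at hbad
  -- `4 n u (1 + τ) < 8 n u` because `τ < 1`.
  nlinarith [hτ.2]
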